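/- Let $G=G_{n,p}$ be the binomial random graph on the vertex set $[n]=\{1,\dots,n\}$, in which each of the $\binom n2$ possible edges is present independently with probability $p$. Identify a subgraph of $G$ with the indicator of its edge set in the edge space $\mathcal E(G)=(\mathbb Z/2)^{E(G)}$. Let $\mathcal C(G)\subseteq\mathcal E(G)$ be the span of the cycles of $G$, let $\mathcal T(G)\subseteq\mathcal C(G)$ be the span of the triangles of $G$, and for a subspace $S\subseteq\mathcal E(G)$ let $S^\perp=\{H\in\mathcal E(G):\langle F,H\rangle=0\ \text{for all } F\in S\}$, where $\langle F,H\rangle=\sum_{e\in E(G)}F_eH_e\in\mathbb Z/2$. (Thus $\mathcal C^\perp(G):=\mathcal C(G)^\perp$ is the set of cuts of $G$; write also $\mathcal T^\perp(G):=\mathcal T(G)^\perp$.) For $F\in\mathcal E(G)$ let $|F|$ be the number of edges of $F$, and let $Q$ be the event that every edge of $G$ is in a triangle of $G$. Then, for every fixed $\eta>0$, $$\sup_{p\in[0,1]}\Pr\Bigl(Q\ \text{ and there is } F\in\mathcal T^\perp(G)\setminus\mathcal C^\perp(G)\text{ with } |F|<(1-\eta)\,\tfrac{n^2p}{4}\Bigr)\longrightarrow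 0\qquad(n\to\infty).$$ -/

import Mathlib

namespace TriangleSpace

open scoped Classical in
/-- The indicator, in the edge space `(ℤ/2)^{E(G)}`, of the set of edges of `G` lying in `S`. -/
noncomputable def edgeIndicator {V : Type*} (G : SimpleGraph V) (S : Set (Sym2 V)) :
    G.edgeSet → ZMod 2 :=
  fun e => if (e : Sym2 V) ∈ S then 1 else 0

/-- The cycle space of `G`: the span of the cycles of `G` in the edge space `(ℤ/2)^{E(G)}`. -/
def cycleSpace {V : Type*} (G : SimpleGraph V) : Submodule (ZMod 2) (G.edgeSet → ZMod 2) :=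
  Submodule.span (ZMod 2)
    {x | ∃ (v : V) (c : G.Walk v v), c.IsCycle ∧ x = edgeIndicator G {e | e ∈ c.edges}}

/-- The triangle space of `G`: the span of the triangles of `G` in the edge space. -/
def triangleSpace {V : Type*} (G : SimpleGraph V) : Submodule (ZMod 2) (G.edgeSet → ZMod 2) :=
  Submodule.span (ZMod 2)
    {x | ∃ u v w : V, G.Adj u v ∧ G.Adj v w ∧ G.Adj u w ∧
      x = edgeIndicator G {s(u, v), s(v, w), s(u, w)}}

open scoped Classical in
/-- The orthogonal complement `{H | ∀ F ∈ S, ⟨F, H⟩ = 0}` of a subspace `S` of the edge space, with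
respect to the usual inner product `⟨F, H⟩ = ∑ e, F e * H e`. -/
noncomputable def perp {V : Type*} [Fintype V] {G : SimpleGraph V}
    (S : Submodule (ZMod 2) (G.edgeSet → ZMod 2)) : Submodule (ZMod 2) (G.edgeSet → ZMod 2) :=
  S.orthogonalBilin (dotProductBilin (ZMod 2) (ZMod 2))

/-- The size `|F|`: the number of edges of the subgraph of `G` with indicator `F`. -/
noncomputable def size {V : Type*} {G : SimpleGraph V} (F : G.edgeSet → ZMod 2) : ℕ :=
  {e | F e ≠ 0}.ncard

/-- The property `Q`: every edge of `G` is in a triangle of `G`. -/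
def EveryEdgeInTriangle {V : Type*} (G : SimpleGraph V) : Prop :=
  ∀ u v : V, G.Adj u v → ∃ w : V, G.Adj u w ∧ G.Adj v w

end TriangleSpace

open Filter Topology

/-! Take `F` of least size in `𝒯^⊥ \ 𝒞^⊥` and let `H` be its edge set, so that each triangle of `G`
has zero or two edges in `H`. Adding the star of a vertex, which is a cut, does not leave `𝒯^⊥ \
𝒞^⊥`; hence by minimality `H` has at most half of the `G`-edges at each vertex. In the link of `v`,
let `A` be the `H`-neighbours and `B` the other neighbours. A triangle with two edges in `H` gives
an edge inside `A` at the vertex where they meet, and an `A`-`B` edge at each of its other two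
vertices. With inner edges counted twice, as ordered pairs, the inner and crossing totals over all
`v` agree (`sum_e2_cross`).

Write `m = np` and `L = np²` for the typical degree and codegree. In a pseudorandom graph, a side of
size `a` in a link of size `d` has about `pa²` inner pairs and `pa(d - a)` crossing edges. Since `a
≤ d/2`, equal totals force `a ≈ d/2` at the vertices carrying almost all of `H`, provided that
vertices of small `H`-degree carry little. At those, the inner term is negligible, so the `H`-edges
there must have small total codegree, although a typical edge has codegree about `L`. Edges of very
small codegree are the only obstacle: no two of them share a vertex, and `Q` puts each in a
triangle, which supplies an adjacent `H`-edge of ordinary codegree (`sum_light_le`).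

Let `W` be the set of vertices with `a ≈ d/2` and `X` its complement, which carries little of `H`.
If `X` is small, `F` is large enough. Otherwise there are many `G`-edges `vb` with `v ∈ W`, `b ∈ X`,
most of them outside `H`. Typically `b` has about `pa` neighbours among the `H`-neighbours of `v`,
and parity puts the edges to them in `H`. This is more of `H` at `X` than there is
(`sum_e2_cross_inter_le`), and `LinkRegular.le_size` follows.

The pseudorandomness holds with high probability once `np² ≥ (5/4) log n` (`pr_not_linkRegular_le`).
Below that, a second moment argument shows that a nonempty `G` is unlikely to satisfy `Q`
(`pr_sparse_le`), and an empty `G` has no such `F`. The constant 5/4 has room on both sides: edges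
in no triangle, about `n²p exp(-np²)` in number, persist up to `np² ≈ (3/2) log n`, while adjacent
pairs of edges of small codegree, roughly `n²L exp(-2L)`, vanish soon after `np² = log n`. All
bounds are uniform in `p`. -/

namespace TriangleSpace
-- Counting in links for a subgraph even on triangles.
section Deterministic
open Finset
open scoped Classical

variable {V : Type*} [Fintype V] {G H : SimpleGraph V}

/-- The real-valued indicator of adjacency. -/
noncomputable def adj (G : SimpleGraph V) (a b : V) : ℝ := if G.Adj a b then 1 else 0

/-- The neighbourhood of a vertex. -/
noncomputable def nb (G : SimpleGraph V) (v : V) : Finset V := univ.filter (G.Adj v)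

/-- The number of pairs in `A ×ˢ B` that are adjacent in `G`. -/
noncomputable def e2 (G : SimpleGraph V) (A B : Finset V) : ℝ := ∑ a ∈ A, ∑ b ∈ B, adj G a b

/-- The number of common neighbours of two vertices. -/
noncomputable def codeg (G : SimpleGraph V) (u v : V) : ℝ := ∑ w, adj G u w * adj G v w

/-- `H` has an even number of edges in every triangle of `G`. -/
def EvenOnTriangles (G H : SimpleGraph V) : Prop :=
  ∀ u v w, G.Adj u v → G.Adj v w → G.Adj u w → (H.Adj u w ↔ ¬(H.Adj u v ↔ H.Adj v w))

lemma adj_nonneg (G : SimpleGraph V) (a b : V) : 0 ≤ adj G a b := by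
  unfold adj; split_ifs <;> norm_num

lemma adj_le_one (G : SimpleGraph V) (a b : V) : adj G a b ≤ 1 := by
  unfold adj; split_ifs <;> norm_num

lemma adj_comm (G : SimpleGraph V) (a b : V) : adj G a b = adj G b a := by
  simp [adj, G.adj_comm]

lemma codeg_comm (G : SimpleGraph V) (a b : V) : codeg G a b = codeg G b a := by
  simp [codeg, mul_comm]

lemma codeg_nonneg (G : SimpleGraph V) (a b : V) : 0 ≤ codeg G a b :=
  sum_nonneg fun _ _ => mul_nonneg (adj_nonneg ..) (adj_nonneg ..)

lemma mem_nb {G : SimpleGraph V} {v w : V} : w ∈ nb G v ↔ G.Adj v w := by simp [nb]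

lemma nb_subset (h : H ≤ G) (v : V) : nb H v ⊆ nb G v := fun w hw => by
  rw [mem_nb] at hw ⊢; exact h hw

lemma sum_nb (G : SimpleGraph V) (v : V) (f : V → ℝ) :
    ∑ w ∈ nb G v, f w = ∑ w, adj G v w * f w := by
  simp [nb, sum_filter, adj]

lemma card_nb (G : SimpleGraph V) (v : V) : (#(nb G v) : ℝ) = ∑ w, adj G v w := by
  simp [nb, adj]

lemma e2_sdiff_right (G : SimpleGraph V) (A : Finset V) {B C : Finset V} (h : C ⊆ B) :
    e2 G A (B \ C) = e2 G A B - e2 G A C := by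
  simp only [e2, ← sum_sub_distrib]
  refine sum_congr rfl fun a _ => ?_
  rw [← sum_sdiff h]; ring

lemma e2_nb_eq_sum_codeg (G : SimpleGraph V) (A : Finset V) (v : V) :
    e2 G A (nb G v) = ∑ w ∈ A, codeg G v w := by
  simp only [e2, sum_nb, codeg]

lemma e2_cross_add_inner (h : H ≤ G) (v : V) :
    e2 G (nb H v) (nb G v \ nb H v) + e2 G (nb H v) (nb H v) = ∑ w ∈ nb H v, codeg G v w := by
  rw [e2_sdiff_right _ _ (nb_subset h v), e2_nb_eq_sum_codeg]; ring

/-- Summed over all vertices, the cut induced in the link has as many edges as its first side. -/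
lemma sum_e2_cross (h : H ≤ G) (hH : EvenOnTriangles G H) :
    ∑ v, e2 G (nb H v) (nb G v \ nb H v) = ∑ v, e2 G (nb H v) (nb H v) := by
  have h1 : ∀ v, e2 G (nb H v) (nb G v \ nb H v)
      = ∑ a, ∑ b, adj H v a * ((adj G v b - adj H v b) * adj G a b) := by
    intro v
    rw [e2_sdiff_right _ _ (nb_subset h v)]
    simp only [e2, sum_nb, mul_sum, ← sum_sub_distrib]
    exact sum_congr rfl fun a _ => sum_congr rfl fun b _ => by ring
  have h2 : ∀ v, e2 G (nb H v) (nb H v)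
      = ∑ a, ∑ b, adj H v a * (adj H v b * adj G a b) := by
    intro v
    simp only [e2, sum_nb, mul_sum]
  simp only [h1, h2]
  -- Exchanging `v` and `a` moves the centre to the other end of the `H`-edge `va`: in a triangle
  -- `vab` with `va` in `H`, the edge `vb` is outside `H` exactly when `ab` is inside.
  rw [sum_comm]
  refine sum_congr rfl fun a _ => sum_congr rfl fun v _ => sum_congr rfl fun b _ => ?_
  by_cases hva : H.Adj v a
  · have hav := hva.symm
    by_cases hvb : G.Adj v b
    · by_cases hab : G.Adj a b
      · have := hH a v b (h hav) hvb hab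
        simp only [adj, hva, hav, hvb, hab, if_true]
        by_cases h3 : H.Adj v b <;> by_cases h4 : H.Adj a b <;> simp_all
      · have : ¬ H.Adj a b := fun h' => hab (h h')
        simp [adj, hab, this]
    · have : ¬ H.Adj v b := fun h' => hvb (h h')
      simp [adj, hvb, this]
  · have hav : ¬ H.Adj a v := fun h' => hva h'.symm
    simp [adj, hva, hav]

/-- Edges of the first side of the cuts induced in the links of vertices of `W`, towards `X`. -/
lemma sum_e2_cross_inter_le (h : H ≤ G) (hH : EvenOnTriangles G H) (W X : Finset V) :
    ∑ v ∈ W, e2 G (nb H v) ((nb G v \ nb H v) ∩ X) ≤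
      ∑ b ∈ X, ∑ w ∈ nb H b, codeg G b w := by
  have h1 : ∀ v, e2 G (nb H v) ((nb G v \ nb H v) ∩ X)
      = ∑ a, ∑ b ∈ X, adj H v a * ((adj G v b - adj H v b) * adj G a b) := by
    intro v
    simp only [e2, sum_nb, mul_sum]
    refine sum_congr rfl fun a _ => ?_
    rw [inter_comm, ← filter_mem_eq_inter, sum_filter]
    refine sum_congr rfl fun b _ => ?_
    by_cases h3 : H.Adj v b
    · simp [mem_nb, adj, h3, h h3]
    · by_cases h4 : G.Adj v b <;> simp [mem_nb, adj, h3, h4]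
  have h2 : ∀ b, ∑ w ∈ nb H b, codeg G b w = ∑ v, ∑ a, adj H b a * (adj G b v * adj G a v) := by
    intro b
    simp only [sum_nb, codeg, mul_sum]
    exact sum_comm
  -- Parity in the triangle `vab` forces `ab` into `H`, so the triple is counted at `b`, with `v` as
  -- a common neighbour of `a` and `b`.
  have hnn : ∀ v a b, adj H v a * ((adj G v b - adj H v b) * adj G a b) ≤
      adj H b a * (adj G b v * adj G a v) := by
    intro v a b
    by_cases hva : H.Adj v a
    · have hav := hva.symm
      by_cases hvb : G.Adj v b
      · by_cases hab : G.Adj a b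
        · have := hH a v b (h hav) hvb hab
          simp only [adj, hva, hvb, hvb.symm, hab, if_true, h hav, H.adj_comm b a]
          by_cases h3 : H.Adj v b <;> by_cases h4 : H.Adj a b <;> simp_all
        · have : ¬ H.Adj a b := fun h' => hab (h h')
          have : ¬ H.Adj b a := fun h' => this h'.symm
          simp [adj, hab, this]
      · have : ¬ H.Adj v b := fun h' => hvb (h h')
        have h5 : ¬ G.Adj b v := fun h' => hvb h'.symm
        simp [adj, hvb, this, h5]
    · simp only [adj, hva, if_false, zero_mul]
      positivity
  calc _ = ∑ v ∈ W, ∑ a, ∑ b ∈ X, adj H v a * ((adj G v b - adj H v b) * adj G a b) :=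
        sum_congr rfl fun v _ => h1 v
    _ ≤ ∑ v ∈ W, ∑ a, ∑ b ∈ X, adj H b a * (adj G b v * adj G a v) :=
        sum_le_sum fun v _ => sum_le_sum fun a _ => sum_le_sum fun b _ => hnn v a b
    _ ≤ ∑ v, ∑ a, ∑ b ∈ X, adj H b a * (adj G b v * adj G a v) := by
        refine sum_le_sum_of_subset_of_nonneg (subset_univ _) fun v _ _ => ?_
        exact sum_nonneg fun _ _ => sum_nonneg fun _ _ =>
          mul_nonneg (adj_nonneg ..) (mul_nonneg (adj_nonneg ..) (adj_nonneg ..))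
    _ = ∑ v, ∑ b ∈ X, ∑ a, adj H b a * (adj G b v * adj G a v) :=
        sum_congr rfl fun v _ => sum_comm
    _ = ∑ b ∈ X, ∑ v, ∑ a, adj H b a * (adj G b v * adj G a v) := sum_comm
    _ = _ := sum_congr rfl fun b _ => (h2 b).symm

/-- If no two edges of small codegree share a vertex, then under `Q` the edges of small codegree in
`H` at light vertices are controlled by the other edges. -/
lemma sum_light_le {τ κ : ℝ} (hκ : 0 < κ) (h : H ≤ G) (hH : EvenOnTriangles G H)
    (hQ : EveryEdgeInTriangle G)
    (hbad : ∀ u v w, G.Adj u v → G.Adj u w → v ≠ w → codeg G u v < τ → τ ≤ codeg G u w)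
    (S : Finset V) (hS : ∀ v ∉ S, κ ≤ #(nb H v)) (hτ : 0 ≤ τ) :
    τ * ∑ v ∈ S, (#(nb H v) : ℝ) ≤
      3 * ∑ v ∈ S, ∑ w ∈ nb H v, codeg G v w + 2 * τ * (∑ v, (#(nb H v) : ℝ)) / κ := by
  set good : V → ℝ := fun v => #((nb H v).filter fun w => τ ≤ codeg G v w) with hgood
  set bad : V → ℝ := fun v => #((nb H v).filter fun w => ¬ τ ≤ codeg G v w) with hbaddef
  have hsplit : ∀ v, (#(nb H v) : ℝ) = good v + bad v := fun v => by
    simp only [hgood, hbaddef]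
    rw [← Nat.cast_add, card_filter_add_card_filter_not]
  have hgood0 : ∀ v, 0 ≤ good v := fun v => by simp [hgood]
  have hbad0 : ∀ v, 0 ≤ bad v := fun v => by simp [hbaddef]
  have hbad1 : ∀ v, bad v ≤ 1 := fun v => by
    simp only [hbaddef]
    norm_cast
    rw [card_le_one]
    intro a ha b hb
    simp only [mem_filter, mem_nb, not_le] at ha hb
    by_contra hab
    exact absurd (hbad v a b (h ha.1) (h hb.1) hab ha.2) (not_le.2 hb.2)
  have hgc : ∀ v, τ * good v ≤ ∑ w ∈ nb H v, codeg G v w := fun v => by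
    calc τ * good v = ∑ w ∈ (nb H v).filter fun w => τ ≤ codeg G v w, τ := by
          simp [hgood, mul_comm]
      _ ≤ ∑ w ∈ (nb H v).filter fun w => τ ≤ codeg G v w, codeg G v w :=
          sum_le_sum fun w hw => (mem_filter.1 hw).2
      _ ≤ _ := sum_le_sum_of_subset_of_nonneg (filter_subset _ _) fun _ _ _ => codeg_nonneg ..
  -- A charge that pays for the low-codegree edges: ordinary `H`-edges pay on `S`, and off `S` the
  -- `H`-degree, at least `κ`, makes the charge at least 1.
  set f : V → ℝ := fun v => if v ∈ S then good v else #(nb H v) / κ with hf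
  have hf0 : ∀ v, 0 ≤ f v := fun v => by
    simp only [hf]; split_ifs
    · exact hgood0 v
    · positivity
  -- By `Q` the edge `vw` has a triangle `vwx`, and parity puts `vx` or `wx` in `H`. That edge
  -- shares a vertex with `vw`, so its codegree is at least `τ`.
  have hkey : ∀ v w, H.Adj v w → codeg G v w < τ → 1 ≤ f v + f w := by
    intro v w hvw hc
    by_cases hv : v ∈ S
    · by_cases hw : w ∈ S
      · obtain ⟨x, hvx, hwx⟩ := hQ v w (h hvw)
        have hpar := hH v w x (h hvw) hwx hvx
        have hxw : w ≠ x := hwx.ne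
        have hxv : v ≠ x := hvx.ne
        by_cases hvx' : H.Adj v x
        · have : 1 ≤ good v := by
            simp only [hgood]
            norm_cast
            rw [Nat.one_le_iff_ne_zero, ← Nat.pos_iff_ne_zero, card_pos]
            exact ⟨x, by simpa [mem_nb, hvx'] using hbad v w x (h hvw) hvx hxw hc⟩
          simp only [hf, hv, hw, if_true]
          linarith [hgood0 w]
        · have hwx' : H.Adj w x := by
            by_contra h'
            simp [hvx', hvw, h'] at hpar
          have : 1 ≤ good w := by
            simp only [hgood]
            norm_cast
            rw [Nat.one_le_iff_ne_zero, ← Nat.pos_iff_ne_zero, card_pos]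
            refine ⟨x, ?_⟩
            simpa [mem_nb, hwx'] using
              hbad w v x (h hvw).symm hwx hxv (by rwa [codeg_comm])
          simp only [hf, hv, hw, if_true]
          linarith [hgood0 v]
      · have : 1 ≤ f w := by
          simp only [hf, hw, if_false]
          rw [le_div_iff₀ hκ]; simpa using hS w hw
        linarith [hf0 v]
    · have : 1 ≤ f v := by
        simp only [hf, hv, if_false]
        rw [le_div_iff₀ hκ]; simpa using hS v hv
      linarith [hf0 w]
  have hbs : ∀ v, ∀ g : V → ℝ, ∑ w ∈ (nb H v).filter (fun w => ¬ τ ≤ codeg G v w), g w =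
      ∑ w, if H.Adj v w ∧ codeg G v w < τ then g w else 0 := fun v g => by
    rw [← sum_filter]
    congr 1
    ext w; simp [mem_nb]
  -- Summing `hkey` over ordered low-codegree pairs charges each vertex twice per low-codegree edge,
  -- and a vertex meets at most one.
  have hbsum : ∑ v, bad v ≤ 2 * ∑ v, f v := by
    have e1 : ∀ v, bad v = ∑ w, if H.Adj v w ∧ codeg G v w < τ then (1 : ℝ) else 0 := fun v => by
      rw [← hbs]; simp [hbaddef]
    have e2 : ∀ v, bad v * f v = ∑ w, if H.Adj v w ∧ codeg G v w < τ then f v else 0 := fun v => by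
      rw [e1, sum_mul]
      exact sum_congr rfl fun w _ => by split_ifs <;> simp
    have e3 : ∑ v, bad v ≤ ∑ v, ∑ w, (if H.Adj v w ∧ codeg G v w < τ then f v + f w else 0) := by
      simp only [e1]
      refine sum_le_sum fun v _ => sum_le_sum fun w _ => ?_
      split_ifs with h'
      · exact hkey v w h'.1 h'.2
      · exact le_rfl
    have e4 : ∑ v, ∑ w, (if H.Adj v w ∧ codeg G v w < τ then f v + f w else 0) =
        2 * ∑ v, bad v * f v := by
      have e5 : ∀ v w, (if H.Adj v w ∧ codeg G v w < τ then f v + f w else 0) =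
          (if H.Adj v w ∧ codeg G v w < τ then f v else 0) +
          (if H.Adj w v ∧ codeg G w v < τ then f w else 0) := fun v w => by
        rw [H.adj_comm w v, codeg_comm G w v]; split_ifs <;> simp
      simp only [e5, sum_add_distrib]
      rw [sum_comm (f := fun v w => if H.Adj w v ∧ codeg G w v < τ then f w else 0)]
      simp only [e2]; ring
    have e6 : ∑ v, bad v * f v ≤ ∑ v, f v :=
      sum_le_sum fun v _ => mul_le_of_le_one_left (hf0 v) (hbad1 v)
    linarith
  have hfs : ∑ v, f v ≤ ∑ v ∈ S, good v + (∑ v, (#(nb H v) : ℝ)) / κ := by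
    rw [sum_div, ← sum_add_sum_compl S f]
    refine add_le_add (sum_le_sum fun v hv => by simp [hf, hv]) ?_
    calc ∑ v ∈ Sᶜ, f v = ∑ v ∈ Sᶜ, (#(nb H v) : ℝ) / κ :=
          sum_congr rfl fun v hv => by simp [hf, mem_compl.1 hv]
      _ ≤ _ := sum_le_sum_of_subset_of_nonneg (subset_univ _) fun _ _ _ => by positivity
  have hbS : ∑ v ∈ S, bad v ≤ ∑ v, bad v :=
    sum_le_sum_of_subset_of_nonneg (subset_univ _) fun _ _ _ => hbad0 _
  have htot : ∑ v ∈ S, (#(nb H v) : ℝ) ≤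
      3 * ∑ v ∈ S, good v + 2 * ((∑ v, (#(nb H v) : ℝ)) / κ) := by
    simp only [hsplit, sum_add_distrib] at *
    linarith
  have hgcs : τ * ∑ v ∈ S, good v ≤ ∑ v ∈ S, ∑ w ∈ nb H v, codeg G v w := by
    rw [mul_sum]; exact sum_le_sum fun v _ => hgc v
  calc _ ≤ τ * (3 * ∑ v ∈ S, good v + 2 * ((∑ v, (#(nb H v) : ℝ)) / κ)) :=
        mul_le_mul_of_nonneg_left htot hτ
    _ = 3 * (τ * ∑ v ∈ S, good v) + 2 * τ * (∑ v, (#(nb H v) : ℝ)) / κ := by ring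
    _ ≤ _ := by linarith

end Deterministic
-- Pseudorandomness forces an even subgraph to be large.
section Regularity
open Finset
open scoped Classical

variable {V : Type*} [Fintype V] {G H : SimpleGraph V}

/-- The pseudorandomness of `G_{n,p}` that is used: degrees, edges within and between subsets of a
neighbourhood, edges between large sets, and the scarcity of edges of small codegree. -/
structure LinkRegular (G : SimpleGraph V) (p ε κ η : ℝ) : Prop where
  le_deg : ∀ v, (1 - ε) * (Fintype.card V * p) ≤ #(nb G v)
  deg_le : ∀ v, (#(nb G v) : ℝ) ≤ (1 + ε) * (Fintype.card V * p)
  light : ∀ A : Finset V, #A ≤ κ * (Fintype.card V * p) →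
    e2 G A A ≤ ε * (Fintype.card V * p ^ 2) * #A
  inner : ∀ v, ∀ A ⊆ nb G v, κ * (Fintype.card V * p) ≤ #A →
    e2 G A A ≤ p * #A ^ 2 + ε * (Fintype.card V * p ^ 2) * #A
  cross : ∀ v, ∀ A ⊆ nb G v, ∀ B ⊆ nb G v, Disjoint A B → κ * (Fintype.card V * p) ≤ #A →
    p * #A * #B - ε * (Fintype.card V * p ^ 2) * #A ≤ e2 G A B
  codeg : ∀ u v w, G.Adj u v → G.Adj u w → v ≠ w → codeg G u v < Fintype.card V * p ^ 2 / 100 →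
    Fintype.card V * p ^ 2 / 100 ≤ codeg G u w
  expand : ∀ W X : Finset V, Disjoint W X → Fintype.card V * p / 4 ≤ #W →
    η * Fintype.card V / 2 ≤ #X → p * #W * #X / 2 ≤ e2 G W X

set_option maxHeartbeats 400000 in
/-- In a regular graph a nonempty subgraph that is even on triangles and has at most half of the
edges at each vertex has at least about half of the edges. -/
theorem LinkRegular.le_size {p κ η : ℝ} (hη : 0 < η) (hη1 : η < 1)
    (hκ : 0 < κ) (hκ1 : κ ≤ 1 / 8) (hp : 0 < p) (hn : 0 < Fintype.card V)
    (hbig : 2 ≤ η ^ 2 / 100000 * (κ * (Fintype.card V * p)))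
    (hG : LinkRegular G p (η ^ 2 / 100000) κ η) (h : H ≤ G) (hH : EvenOnTriangles G H)
    (hQ : EveryEdgeInTriangle G) (hhalf : ∀ v, 2 * (#(nb H v) : ℝ) ≤ #(nb G v))
    (hne : 0 < ∑ v, (#(nb H v) : ℝ)) :
    (1 - η) * (Fintype.card V : ℝ) ^ 2 * p / 2 ≤ ∑ v, (#(nb H v) : ℝ) := by
  by_contra! hD
  set n : ℝ := (Fintype.card V : ℝ) with hndef
  have hn0 : 0 < n := by simpa [hndef] using hn
  set m : ℝ := n * p with hm
  have hm0 : 0 < m := by positivity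
  have hL : n * p ^ 2 = m * p := by rw [hm]; ring
  set ε : ℝ := η ^ 2 / 100000 with hε
  have hε0 : 0 < ε := by positivity
  have hεη : ε ≤ η / 100000 := by rw [hε]; nlinarith
  set D : ℝ := ∑ v, (#(nb H v) : ℝ) with hDdef
  set L : ℝ := m * p with hLdef
  have hL0 : 0 < L := by positivity
  clear_value D L ε
  set a : V → ℝ := fun v => (#(nb H v) : ℝ) with ha
  set d : V → ℝ := fun v => (#(nb G v) : ℝ) with hd
  set x : V → ℝ := fun v => e2 G (nb H v) (nb G v \ nb H v) with hx
  set i : V → ℝ := fun v => e2 G (nb H v) (nb H v) with hi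
  set c : V → ℝ := fun v => ∑ w ∈ nb H v, TriangleSpace.codeg G v w with hc
  have ha0 : ∀ v, 0 ≤ a v := fun v => by simp [ha]
  have hDa : D = ∑ v, a v := hDdef
  have hxi : ∀ v, x v + i v = c v := fun v => e2_cross_add_inner h v
  have hsum : ∑ v, x v = ∑ v, i v := sum_e2_cross h hH
  have hd1 : ∀ v, (1 - ε) * m ≤ d v := hG.le_deg
  have hd2 : ∀ v, d v ≤ (1 + ε) * m := hG.deg_le
  have had : ∀ v, 2 * a v ≤ d v := hhalf
  have ham : ∀ v, a v ≤ (1 + ε) * m / 2 := fun v => by linarith [had v, hd2 v]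
  have ham1 : ∀ v, a v ≤ m := fun v => by
    linarith [ham v, mul_le_of_le_one_left hm0.le (show ε ≤ 1 by linarith)]
  set S : Finset V := univ.filter fun v => a v < κ * m with hS
  have hil : ∀ v ∈ S, i v ≤ ε * L * a v := fun v hv => by
    have := hG.light (nb H v) (le_of_lt (by simpa [hS] using hv))
    rwa [hL] at this
  have hih : ∀ v ∉ S, i v ≤ p * a v ^ 2 + ε * L * a v := fun v hv => by
    have := hG.inner v (nb H v) (nb_subset h v) (by simpa [hS] using hv)
    rwa [hL] at this
  have hcr : ∀ v ∉ S, ∀ B ⊆ nb G v \ nb H v, p * a v * #B - ε * L * a v ≤ e2 G (nb H v) B :=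
    fun v hv B hB => by
      have := hG.cross v (nb H v) (nb_subset h v) B (hB.trans sdiff_subset)
        (disjoint_of_subset_right hB disjoint_sdiff) (by simpa [hS] using hv)
      rwa [hL] at this
  have hi2 : ∀ v, i v ≤ 2 * L * a v := fun v => by
    have h1 : p * a v ^ 2 ≤ L * a v := by
      have := mul_le_mul_of_nonneg_left (ham1 v) (mul_nonneg hp.le (ha0 v))
      rw [hLdef]; linarith
    have h2 : 0 ≤ (1 - ε) * (L * a v) :=
      mul_nonneg (by linarith) (mul_nonneg hL0.le (ha0 v))
    have h3 : 0 ≤ p * a v ^ 2 := by positivity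
    by_cases hv : v ∈ S
    · linarith [hil v hv, mul_nonneg hL0.le (ha0 v)]
    · linarith [hih v hv]
  have hc0 : ∀ v, 0 ≤ c v := fun v => sum_nonneg fun w _ => codeg_nonneg ..
  -- The main term of crossing minus inner. At light vertices the inner part is an error and the
  -- whole codegree sum remains; at heavy ones `pa(d - a) - pa²` remains. As the differences sum to
  -- zero, the sum of `φ` is at most the accumulated errors.
  set φ : V → ℝ := fun v => if v ∈ S then c v else p * a v * (d v - 2 * a v) with hφ
  have hφ0 : ∀ v, 0 ≤ φ v := fun v => by
    simp only [hφ]; split_ifs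
    · exact hc0 v
    · exact mul_nonneg (mul_nonneg hp.le (ha0 v)) (by linarith [had v])
  have hg : ∀ v, φ v - 2 * ε * L * a v ≤ x v - i v := fun v => by
    by_cases hv : v ∈ S
    · simp only [hφ, hv, if_true]
      linarith [hil v hv, hxi v]
    · simp only [hφ, hv, if_false]
      have h1 := hcr v hv _ (Subset.refl _)
      rw [card_sdiff_of_subset (nb_subset h v), Nat.cast_sub (card_le_card (nb_subset h v))] at h1
      have h2 := hih v hv
      simp only [hx]
      have : p * a v * (d v - a v) - ε * L * a v ≤ e2 G (nb H v) (nb G v \ nb H v) := h1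
      linarith
  have hφsum : ∑ v, φ v ≤ 2 * ε * L * D := by
    have : ∑ v, (φ v - 2 * ε * L * a v) ≤ ∑ v, (x v - i v) := sum_le_sum fun v _ => hg v
    rw [sum_sub_distrib, sum_sub_distrib, ← mul_sum, hsum, ← hDa] at this
    linarith
  -- Here 600 is `3 · 2 · 100`, from `sum_light_le`, `hφsum` and the threshold `L / 100`; the
  -- remaining 1 pays for the heavy vertices by way of `hbig`.
  have hSa : ∑ v ∈ S, a v ≤ 601 * ε * D := by
    have h1 := sum_light_le (κ := κ * m) (τ := L / 100) (by positivity) h hH hQ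
      (fun u v w h1 h2 h3 h4 => by
        have := hG.codeg u v w h1 h2 h3
        rw [hL] at this; exact this h4) S
      (fun v hv => by simpa [hS] using hv) (by positivity)
    have h2 : ∑ v ∈ S, c v ≤ ∑ v, φ v := by
      calc ∑ v ∈ S, c v = ∑ v ∈ S, φ v := sum_congr rfl fun v hv => by simp [hφ, hv]
        _ ≤ _ := sum_le_sum_of_subset_of_nonneg (subset_univ _) fun v _ _ => hφ0 v
    have h3 : 2 * (L / 100) * D / (κ * m) ≤ ε * L / 100 * D := by
      rw [div_le_iff₀ (by positivity)]
      have := mul_le_mul_of_nonneg_right hbig (show 0 ≤ L * D / 100 by positivity)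
      linarith
    rw [← hDdef] at h1
    have h4 : L / 100 * ∑ v ∈ S, a v ≤ 3 * ∑ v ∈ S, c v + 2 * (L / 100) * D / (κ * m) := h1
    have h5 : L / 100 * ∑ v ∈ S, a v ≤ L / 100 * (601 * ε * D) := by linarith
    exact le_of_mul_le_mul_left h5 (by positivity)
  set W : Finset V := univ.filter fun v => d v - 2 * a v ≤ η / 4 * m with hW
  -- Light vertices contribute 601. Heavy vertices outside `W` have `φ ≥ (η / 4) L a`, and dividing
  -- `hφsum` by `(η / 4) L` gives the other 8.
  have hXa : ∑ v ∈ Wᶜ, a v ≤ 609 * η / 100000 * D := by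
    have h1 : ∀ v ∈ Wᶜ, a v ≤ (if v ∈ S then a v else 0) + φ v / (L * (η / 4)) := fun v hv => by
      have hv' : η / 4 * m < d v - 2 * a v := by
        simpa only [hW, mem_compl, mem_filter, mem_univ, true_and, not_le] using hv
      by_cases hvS : v ∈ S
      · simp only [hvS, if_true]
        have := hφ0 v
        have : 0 ≤ φ v / (L * (η / 4)) := by positivity
        linarith
      · simp only [hφ, hvS, if_false, zero_add]
        rw [le_div_iff₀ (by positivity)]
        have := mul_le_mul_of_nonneg_left hv'.le (mul_nonneg hp.le (ha0 v))
        rw [hLdef]; linarith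
    have h2 : ∑ v ∈ Wᶜ, a v ≤ ∑ v ∈ S, a v + (∑ v, φ v) / (L * (η / 4)) := by
      refine (sum_le_sum h1).trans ?_
      rw [sum_add_distrib, sum_div]
      refine add_le_add ?_ ?_
      · rw [← sum_filter]
        refine sum_le_sum_of_subset_of_nonneg (fun v hv => (mem_filter.1 hv).2) fun v _ _ => ha0 v
      · exact sum_le_sum_of_subset_of_nonneg (subset_univ _) fun v _ _ =>
          div_nonneg (hφ0 v) (by positivity)
    have h3 : (∑ v, φ v) / (L * (η / 4)) ≤ 8 * η / 100000 * D := by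
      rw [div_le_iff₀ (by positivity)]
      refine hφsum.trans (le_of_eq ?_)
      rw [hε]; ring
    have h4 : 601 * ε * D ≤ 601 * (η / 100000) * D := by gcongr
    linarith
  have hWa : ∀ v ∈ W, m / 3 ≤ a v := fun v hv => by
    have hv' : d v - 2 * a v ≤ η / 4 * m := (mem_filter.1 hv).2
    have h1 : η / 4 * m ≤ 1 / 4 * m := by gcongr
    have h2 : ε * m ≤ 1 / 100000 * m := by gcongr; linarith
    linarith [hd1 v]
  have hWS : ∀ v ∈ W, v ∉ S := fun v hv => by
    have := hWa v hv
    simp only [hS, mem_filter, mem_univ, true_and, not_lt]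
    have : κ * m ≤ 1 / 8 * m := by gcongr
    linarith
  have hsplit : D = ∑ v ∈ W, a v + ∑ v ∈ Wᶜ, a v := by rw [sum_add_sum_compl, hDa]
  have hηD : η * D ≤ D := mul_le_of_le_one_left hne.le hη1.le
  have hcardX : (#Wᶜ : ℝ) = n - #W := by
    rw [card_compl, Nat.cast_sub (card_le_univ W)]
  -- Otherwise more than `(1 - η/2)n` vertices have `H`-degree at least `(1 - η/2)m/2`, and `(1 -
  -- η/2)² ≥ 1 - η` contradicts `hD`.
  have hXcard : η * n / 2 ≤ #Wᶜ := by
    rw [hcardX]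
    by_contra! hlt
    have h1 : (#W : ℝ) * ((1 - η / 2) * m / 2) ≤ ∑ v ∈ W, a v := by
      rw [← nsmul_eq_mul, ← sum_const]
      refine sum_le_sum fun v hv => ?_
      have hv' : d v - 2 * a v ≤ η / 4 * m := (mem_filter.1 hv).2
      have h2 : ε * m ≤ η / 100000 * m := by gcongr
      linarith [hd1 v, mul_pos hη hm0]
    have h2 : 0 ≤ ∑ v ∈ Wᶜ, a v := sum_nonneg fun v _ => ha0 v
    have h3 : (1 - η / 2) * n * ((1 - η / 2) * m / 2) ≤ #W * ((1 - η / 2) * m / 2) := by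
      refine mul_le_mul_of_nonneg_right (by linarith) ?_
      exact div_nonneg (mul_nonneg (by linarith) hm0.le) (by norm_num)
    have h4 : (1 - η) * n ^ 2 * p / 2 = (1 - η) * (n * m) / 2 := by rw [hm]; ring
    have h5 : 0 < n * m := by positivity
    linarith [mul_nonneg (sq_nonneg η) h5.le]
  have hDW : D ≤ #W * m := by
    have h1 : ∑ v ∈ W, a v ≤ #W * ((1 + ε) * m / 2) := by
      rw [← nsmul_eq_mul, ← sum_const]
      exact sum_le_sum fun v _ => ham v
    have h2 : (#W : ℝ) * ((1 + ε) * m / 2) ≤ #W * (6 / 10 * m) := by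
      gcongr
      linarith [mul_le_mul_of_nonneg_right (show ε ≤ 1 / 10 by linarith) hm0.le]
    linarith
  have hW0 : (0 : ℝ) < #W := by
    by_contra! h0
    have : (#W : ℝ) * m ≤ 0 := mul_nonpos_of_nonpos_of_nonneg h0 hm0.le
    linarith
  have hHWX : e2 H W Wᶜ ≤ ∑ v ∈ Wᶜ, a v := by
    simp only [e2]
    rw [sum_comm]
    refine sum_le_sum fun v _ => ?_
    simp only [ha, card_nb, adj_comm H _ v]
    exact sum_le_sum_of_subset_of_nonneg (subset_univ _) fun w _ _ => adj_nonneg ..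
  -- Vertices of `W` have at least `m / 3` `H`-neighbours each, few of them outside `W` in total, so
  -- `W` must be large enough to hold the rest.
  have hWcard : m / 4 ≤ #W := by
    have h1 : ∑ v ∈ W, a v = e2 H W W + e2 H W Wᶜ := by
      simp only [e2, ha, card_nb, ← sum_add_distrib, sum_add_sum_compl]
    have h2 : e2 H W W ≤ #W * #W := by
      simp only [e2]
      calc _ ≤ ∑ v ∈ W, ∑ w ∈ W, (1 : ℝ) := sum_le_sum fun _ _ => sum_le_sum fun _ _ => adj_le_one ..
        _ = _ := by simp
    have h3 : #W * (m / 3) ≤ ∑ v ∈ W, a v := by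
      rw [← nsmul_eq_mul, ← sum_const]
      exact sum_le_sum fun v hv => hWa v hv
    have h4 : #W * (m / 4) ≤ (#W : ℝ) * #W := by
      linarith [mul_pos hW0 hm0]
    exact le_of_mul_le_mul_left h4 hW0
  have hexp : D * (η / 4) ≤ e2 G W Wᶜ := by
    have h1 := hG.expand W Wᶜ disjoint_compl_right hWcard hXcard
    have h2 : p * #W * (η * n / 2) / 2 ≤ p * #W * #Wᶜ / 2 := by gcongr
    have h3 : p * #W * (η * n / 2) / 2 = #W * m * (η / 4) := by rw [hm]; ring
    have h4 : D * (η / 4) ≤ #W * m * (η / 4) := by gcongr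
    linarith
  -- For `v` in `W` the first side of the link has at least `m / 3` vertices, so each vertex of the
  -- other side receives at least about `L / 3` edges from it; 1/4 is a rounding.
  have hZge : L / 4 * e2 G W Wᶜ - L * e2 H W Wᶜ - ε * L * D ≤
      ∑ v ∈ W, e2 G (nb H v) ((nb G v \ nb H v) ∩ Wᶜ) := by
    have h1 : ∀ v ∈ W, L / 4 * ∑ w ∈ Wᶜ, adj G v w - L * ∑ w ∈ Wᶜ, adj H v w - ε * L * a v ≤
        e2 G (nb H v) ((nb G v \ nb H v) ∩ Wᶜ) := fun v hv => by
      have h2 := hcr v (hWS v hv) ((nb G v \ nb H v) ∩ Wᶜ) inter_subset_left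
      have h3 : (#((nb G v \ nb H v) ∩ Wᶜ) : ℝ) =
          ∑ w ∈ Wᶜ, adj G v w - ∑ w ∈ Wᶜ, adj H v w := by
        rw [← sum_sub_distrib, inter_comm, ← filter_mem_eq_inter, card_filter]
        push_cast
        refine sum_congr rfl fun w _ => ?_
        by_cases h4 : H.Adj v w
        · simp [mem_nb, adj, h4, h h4]
        · by_cases h5 : G.Adj v w <;> simp [mem_nb, adj, h4, h5]
      rw [h3] at h2
      have h4 : 0 ≤ ∑ w ∈ Wᶜ, adj G v w := sum_nonneg fun _ _ => adj_nonneg ..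
      have h5 : 0 ≤ ∑ w ∈ Wᶜ, adj H v w := sum_nonneg fun _ _ => adj_nonneg ..
      have h6 : L / 4 * ∑ w ∈ Wᶜ, adj G v w ≤ p * a v * ∑ w ∈ Wᶜ, adj G v w := by
        refine mul_le_mul_of_nonneg_right ?_ h4
        have : p * (m / 3) ≤ p * a v := mul_le_mul_of_nonneg_left (hWa v hv) hp.le
        linarith
      have h7 : p * a v * ∑ w ∈ Wᶜ, adj H v w ≤ L * ∑ w ∈ Wᶜ, adj H v w := by
        refine mul_le_mul_of_nonneg_right ?_ h5
        have : p * a v ≤ p * m := mul_le_mul_of_nonneg_left (ham1 v) hp.le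
        rw [hLdef]; linarith
      linarith
    have h2 := sum_le_sum h1
    rw [sum_sub_distrib, sum_sub_distrib, ← mul_sum, ← mul_sum, ← mul_sum] at h2
    have h3 : ε * L * ∑ v ∈ W, a v ≤ ε * L * D := by
      refine mul_le_mul_of_nonneg_left ?_ (by positivity)
      have : 0 ≤ ∑ v ∈ Wᶜ, a v := sum_nonneg fun v _ => ha0 v
      linarith
    simp only [e2] at h2 ⊢
    linarith
  have hZle := sum_e2_cross_inter_le h hH W Wᶜ
  -- Write `c = (x - i) + 2i`. Since `x - i` sums to zero overall and is almost nonnegative on `W`,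
  -- its sum over the complement is at most an error term.
  have hcX : ∑ v ∈ Wᶜ, c v ≤ 2 * ε * L * D + 4 * L * ∑ v ∈ Wᶜ, a v := by
    have h1 : ∑ v ∈ Wᶜ, c v = ∑ v ∈ Wᶜ, (x v - i v) + 2 * ∑ v ∈ Wᶜ, i v := by
      rw [mul_sum, ← sum_add_distrib]
      exact sum_congr rfl fun v _ => by rw [← hxi]; ring
    have h2 : ∑ v ∈ W, (x v - i v) + ∑ v ∈ Wᶜ, (x v - i v) = 0 := by
      rw [sum_add_sum_compl, sum_sub_distrib, hsum, sub_self]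
    have h3 : -(2 * ε * L * ∑ v ∈ W, a v) ≤ ∑ v ∈ W, (x v - i v) := by
      rw [mul_sum, ← sum_neg_distrib]
      exact sum_le_sum fun v _ => by linarith [hg v, hφ0 v]
    have h4 : ∑ v ∈ Wᶜ, i v ≤ 2 * L * ∑ v ∈ Wᶜ, a v := by
      rw [mul_sum]; exact sum_le_sum fun v _ => hi2 v
    have h5 : 2 * ε * L * ∑ v ∈ W, a v ≤ 2 * ε * L * D := by
      refine mul_le_mul_of_nonneg_left ?_ (by positivity)
      have : 0 ≤ ∑ v ∈ Wᶜ, a v := sum_nonneg fun v _ => ha0 v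
      linarith
    linarith
  -- In units of `η L D / 100000`, the gain is 6250 and the errors total `5 · 609 + 3 = 3048`.
  have hfin1 : L * (η / 16 * D) ≤ L / 4 * e2 G W Wᶜ := by
    linarith [mul_le_mul_of_nonneg_left hexp hL0.le]
  have hfin2 : L * e2 H W Wᶜ ≤ L * (609 * η / 100000 * D) := by
    gcongr; linarith
  have hfin3 : L * ∑ v ∈ Wᶜ, a v ≤ L * (609 * η / 100000 * D) := by gcongr
  have hfin4 : L * (ε * D) ≤ L * (η / 100000 * D) := by gcongr
  have hfin5 : ∑ v ∈ W, e2 G (nb H v) ((nb G v \ nb H v) ∩ Wᶜ) ≤ ∑ v ∈ Wᶜ, c v := hZle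
  have : 0 < L * (η * D) := by positivity
  linarith

end Regularity
-- The binomial random graph as a finite weighted sum: independence, Chernoff bounds, conditioning
-- on a neighbourhood.
section Percolation
open Finset
open scoped Classical

variable {α : Type*} [DecidableEq α]

/-- The probability that the random subset of `T` is `s`. -/
noncomputable def wt (p : ℝ) (T s : Finset α) : ℝ := ∏ e ∈ T, if e ∈ s then p else 1 - p

/-- The expectation of `f` at a random subset of `T`, each element being present with
probability `p`. -/
noncomputable def exOn (p : ℝ) (T : Finset α) (f : Finset α → ℝ) : ℝ :=
  ∑ s ∈ T.powerset, wt p T s * f s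

lemma wt_nonneg {p : ℝ} (h0 : 0 ≤ p) (h1 : p ≤ 1) (T s : Finset α) : 0 ≤ wt p T s :=
  prod_nonneg fun e _ => by split_ifs <;> linarith

lemma wt_eq {p : ℝ} {T s : Finset α} (h : s ⊆ T) :
    wt p T s = p ^ #s * (1 - p) ^ #(T \ s) := by
  rw [wt, prod_ite, prod_const, prod_const, filter_mem_eq_inter, inter_eq_right.2 h]
  congr 3
  ext; simp

lemma exOn_const (p : ℝ) (T : Finset α) (c : ℝ) : exOn p T (fun _ => c) = c := by
  have := prod_add (fun _ : α => p) (fun _ => 1 - p) T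
  simp only [add_sub_cancel, prod_const_one, prod_const] at this
  rw [exOn, ← sum_mul, sum_congr rfl fun s hs => wt_eq (mem_powerset.1 hs), ← this, one_mul]

/-- The weight is a product over elements, so it splits along `s ↦ (s ∩ T, s ∩ T')`. All
independence statements below rest on this. -/
lemma exOn_union (p : ℝ) {T T' : Finset α} (h : Disjoint T T') (f : Finset α → ℝ) :
    exOn p (T ∪ T') f =
      ∑ s ∈ T.powerset, ∑ t ∈ T'.powerset, wt p T s * wt p T' t * f (s ∪ t) := by
  rw [exOn, ← sum_product']
  refine sum_nbij' (fun s => (s ∩ T, s ∩ T')) (fun q => q.1 ∪ q.2) ?_ ?_ ?_ ?_ ?_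
  · intro s _
    simp
  · rintro ⟨s, t⟩ hq
    simp only [mem_product, mem_powerset] at hq ⊢
    exact union_subset_union hq.1 hq.2
  · intro s hs
    simp only [mem_powerset] at hs
    simp [← inter_union_distrib_left, hs]
  · rintro ⟨s, t⟩ hq
    simp only [mem_product, mem_powerset] at hq
    have h1 : Disjoint t T := (h.mono_right hq.2).symm
    have h2 : Disjoint s T' := h.mono_left hq.1
    simp [union_inter_distrib_right, inter_eq_left.2 hq.1, inter_eq_left.2 hq.2,
      disjoint_iff_inter_eq_empty.1 h1, disjoint_iff_inter_eq_empty.1 h2]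
  · intro s hs
    simp only [mem_powerset] at hs
    simp only [← inter_union_distrib_left, inter_eq_left.2 hs]
    congr 1
    rw [wt, prod_union h]
    congr 1 <;> exact prod_congr rfl fun e he => by simp [he]

lemma exOn_mul (p : ℝ) {T T' : Finset α} (h : Disjoint T T') {f g : Finset α → ℝ}
    (hf : ∀ s t, s ⊆ T → t ⊆ T' → f (s ∪ t) = f s) (hg : ∀ s t, s ⊆ T → t ⊆ T' → g (s ∪ t) = g t) :
    exOn p (T ∪ T') (fun s => f s * g s) = exOn p T f * exOn p T' g := by
  rw [exOn_union p h, exOn, exOn, sum_mul_sum]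
  refine sum_congr rfl fun s hs => sum_congr rfl fun t ht => ?_
  rw [mem_powerset] at hs ht
  rw [hf s t hs ht, hg s t hs ht]; ring

lemma exOn_union_left (p : ℝ) {T T' : Finset α} (h : Disjoint T T') {f : Finset α → ℝ}
    (hf : ∀ s t, s ⊆ T → t ⊆ T' → f (s ∪ t) = f s) :
    exOn p (T ∪ T') f = exOn p T f := by
  have := exOn_mul p h (f := f) (g := fun _ => 1) hf (fun _ _ _ _ => rfl)
  simpa [exOn_const] using this

variable {V : Type*} [Fintype V]

/-- The possible edges of a graph on `V`. -/
noncomputable def pairs (V : Type*) [Fintype V] : Finset (Sym2 V) := univ.filter fun e => ¬ e.IsDiag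

/-- Expectation with respect to the binomial random graph. -/
noncomputable def ex (p : ℝ) (f : SimpleGraph V → ℝ) : ℝ :=
  exOn p (pairs V) fun s => f (SimpleGraph.fromEdgeSet s)

/-- Probability with respect to the binomial random graph. -/
noncomputable def pr (p : ℝ) (S : Set (SimpleGraph V)) : ℝ := ex p (S.indicator 1)

/-- `f G` is determined by the edges of `G` in `T`. -/
def DependsOn {β : Type*} (f : SimpleGraph V → β) (T : Set (Sym2 V)) : Prop :=
  ∀ G G' : SimpleGraph V, (∀ e ∈ T, ¬ e.IsDiag → (e ∈ G.edgeSet ↔ e ∈ G'.edgeSet)) → f G = f G'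

lemma DependsOn.mul {f g : SimpleGraph V → ℝ} {T T' : Set (Sym2 V)}
    (hf : DependsOn f T) (hg : DependsOn g T') : DependsOn (fun G => f G * g G) (T ∪ T') :=
  fun G G' h => by
    simp only
    rw [hf G G' fun e he => h e (Or.inl he), hg G G' fun e he => h e (Or.inr he)]

lemma DependsOn.prod {ι : Type*} {I : Finset ι} {f : ι → SimpleGraph V → ℝ}
    {T : ι → Set (Sym2 V)} (hf : ∀ i ∈ I, DependsOn (f i) (T i)) :
    DependsOn (fun G => ∏ i ∈ I, f i G) (⋃ i ∈ I, T i) :=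
  fun G G' h => prod_congr rfl fun i hi => hf i hi G G' fun e he =>
    h e (Set.mem_biUnion hi he)

lemma DependsOn.comp {β γ : Type*} {f : SimpleGraph V → β} {T : Set (Sym2 V)}
    (hf : DependsOn f T) (φ : β → γ) : DependsOn (fun G => φ (f G)) T :=
  fun G G' h => by simp only; rw [hf G G' h]

lemma dependsOn_adj (a b : V) : DependsOn (fun G => adj G a b) {s(a, b)} := fun G G' h => by
  by_cases hab : a = b
  · subst hab; simp [adj]
  · have := h s(a, b) rfl (by simpa using hab)
    simp only [SimpleGraph.mem_edgeSet] at this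
    simp [adj, this]

lemma mem_fromEdgeSet_iff {T : Finset (Sym2 V)} {e : Sym2 V} (he : ¬ e.IsDiag) :
    e ∈ (SimpleGraph.fromEdgeSet (T : Set (Sym2 V))).edgeSet ↔ e ∈ T := by
  simp [SimpleGraph.edgeSet_fromEdgeSet, he]

lemma ex_const (p : ℝ) (c : ℝ) : ex p (fun _ : SimpleGraph V => c) = c := exOn_const ..

lemma ex_add (p : ℝ) (f g : SimpleGraph V → ℝ) :
    ex p (fun G => f G + g G) = ex p f + ex p g := by
  simp [ex, exOn, mul_add, sum_add_distrib]

lemma ex_sub (p : ℝ) (f g : SimpleGraph V → ℝ) :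
    ex p (fun G => f G - g G) = ex p f - ex p g := by
  simp [ex, exOn, mul_sub, sum_sub_distrib]

lemma ex_const_mul (p c : ℝ) (f : SimpleGraph V → ℝ) :
    ex p (fun G => c * f G) = c * ex p f := by
  simp only [ex, exOn, mul_sum]
  exact sum_congr rfl fun _ _ => by ring

lemma ex_sum {ι : Type*} (p : ℝ) (I : Finset ι) (f : ι → SimpleGraph V → ℝ) :
    ex p (fun G => ∑ i ∈ I, f i G) = ∑ i ∈ I, ex p (f i) := by
  simp only [ex, exOn, mul_sum]
  exact sum_comm

lemma ex_mono {p : ℝ} (h0 : 0 ≤ p) (h1 : p ≤ 1) {f g : SimpleGraph V → ℝ} (h : ∀ G, f G ≤ g G) :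
    ex p f ≤ ex p g :=
  sum_le_sum fun _ _ => mul_le_mul_of_nonneg_left (h _) (wt_nonneg h0 h1 ..)

lemma ex_nonneg {p : ℝ} (h0 : 0 ≤ p) (h1 : p ≤ 1) {f : SimpleGraph V → ℝ} (h : ∀ G, 0 ≤ f G) :
    0 ≤ ex p f := by
  simpa [ex_const] using ex_mono h0 h1 (f := fun _ => 0) h

lemma ex_eq_exOn (p : ℝ) {f : SimpleGraph V → ℝ} {T : Finset (Sym2 V)} (hT : T ⊆ pairs V)
    (hf : DependsOn f T) : ex p f = exOn p T fun s => f (SimpleGraph.fromEdgeSet s) := by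
  have hu : ex p f = exOn p (T ∪ pairs V \ T) fun s => f (SimpleGraph.fromEdgeSet s) := by
    rw [union_sdiff_of_subset hT]; rfl
  rw [hu]
  refine exOn_union_left p disjoint_sdiff fun s t _ ht => ?_
  refine hf _ _ fun e he hd => ?_
  rw [mem_fromEdgeSet_iff hd, mem_fromEdgeSet_iff hd, mem_union, or_iff_left]
  exact fun het => (mem_sdiff.1 (ht het)).2 he

/-- Independence of functions of disjoint sets of edges. -/
lemma ex_mul (p : ℝ) {f g : SimpleGraph V → ℝ} {T T' : Set (Sym2 V)} (hf : DependsOn f T)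
    (hg : DependsOn g T') (h : ∀ e ∈ T, e ∈ T' → e.IsDiag) :
    ex p (fun G => f G * g G) = ex p f * ex p g := by
  set A : Finset (Sym2 V) := (pairs V).filter (· ∈ T) with hA
  have hAp : A ⊆ pairs V := filter_subset _ _
  have hfA : DependsOn f A := fun G G' hG => hf G G' fun e he hd =>
    hG e (by simpa [hA, pairs, hd] using he) hd
  have hgA : DependsOn g (pairs V \ A : Finset (Sym2 V)) := fun G G' hG => hg G G' fun e he hd =>
    hG e (by
      simp only [hA, pairs, coe_sdiff, coe_filter, mem_filter, mem_univ, true_and, Set.mem_sdiff,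
        Set.mem_ofPred_eq, hd, not_false_eq_true]
      exact fun h' => hd (h e h' he)) hd
  have hu : ex p (fun G => f G * g G) = exOn p (A ∪ pairs V \ A) fun s =>
      f (SimpleGraph.fromEdgeSet s) * g (SimpleGraph.fromEdgeSet s) := by
    rw [union_sdiff_of_subset hAp]; rfl
  rw [ex_eq_exOn p hAp hfA, ex_eq_exOn p sdiff_subset hgA, hu, exOn_mul p disjoint_sdiff]
  · intro s t _ ht
    refine hfA _ _ fun e he hd => ?_
    rw [mem_fromEdgeSet_iff hd, mem_fromEdgeSet_iff hd, mem_union, or_iff_left]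
    exact fun het => (mem_sdiff.1 (ht het)).2 he
  · intro s t hs _
    refine hgA _ _ fun e he hd => ?_
    rw [mem_fromEdgeSet_iff hd, mem_fromEdgeSet_iff hd, mem_union, or_iff_right]
    exact fun hes => (mem_sdiff.1 (mem_coe.1 he)).2 (hs hes)

lemma ex_prod {ι : Type*} (p : ℝ) (I : Finset ι) {f : ι → SimpleGraph V → ℝ}
    {T : ι → Set (Sym2 V)} (hf : ∀ i ∈ I, DependsOn (f i) (T i))
    (h : ∀ i ∈ I, ∀ j ∈ I, i ≠ j → ∀ e ∈ T i, e ∈ T j → e.IsDiag) :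
    ex p (fun G => ∏ i ∈ I, f i G) = ∏ i ∈ I, ex p (f i) := by
  induction I using Finset.induction_on with
  | empty => simp [ex_const]
  | insert i I hi ih =>
    simp only [prod_insert hi]
    rw [ex_mul p (hf i (mem_insert_self _ _))
      (DependsOn.prod fun j hj => hf j (mem_insert_of_mem hj)),
      ih (fun j hj => hf j (mem_insert_of_mem hj)) fun j hj k hk =>
        h j (mem_insert_of_mem hj) k (mem_insert_of_mem hk)]
    intro e he he'
    obtain ⟨j, hj, hej⟩ := Set.mem_iUnion₂.1 he'
    exact h i (mem_insert_self _ _) j (mem_insert_of_mem hj) (fun h' => hi (h' ▸ hj)) e he hej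

lemma ex_comp_adj (p : ℝ) {a b : V} (hab : a ≠ b) (φ : ℝ → ℝ) :
    ex p (fun G => φ (adj G a b)) = p * φ 1 + (1 - p) * φ 0 := by
  have hd : DependsOn (fun G => φ (adj G a b)) (({s(a, b)} : Finset (Sym2 V)) : Set (Sym2 V)) := by
    rw [coe_singleton]; exact (dependsOn_adj a b).comp φ
  rw [ex_eq_exOn p (by simpa [pairs] using hab) hd, exOn,
    ← insert_empty_eq, sum_powerset_insert (notMem_empty _)]
  simp [wt, adj, hab]
  ring

lemma ex_adj (p : ℝ) {a b : V} (hab : a ≠ b) : ex p (fun G => adj G a b) = p := by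
  rw [ex_comp_adj p hab (fun x => x)]; ring

lemma pr_mono {p : ℝ} (h0 : 0 ≤ p) (h1 : p ≤ 1) {S S' : Set (SimpleGraph V)} (h : S ⊆ S') :
    pr p S ≤ pr p S' :=
  ex_mono h0 h1 fun _ => Set.indicator_le_indicator_of_subset h (fun _ => zero_le_one) _

lemma pr_nonneg {p : ℝ} (h0 : 0 ≤ p) (h1 : p ≤ 1) (S : Set (SimpleGraph V)) : 0 ≤ pr p S :=
  ex_nonneg h0 h1 fun _ => Set.indicator_nonneg (fun _ _ => zero_le_one) _

lemma pr_le_ex {p : ℝ} (h0 : 0 ≤ p) (h1 : p ≤ 1) {S : Set (SimpleGraph V)}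
    {f : SimpleGraph V → ℝ} (hf : ∀ G, 0 ≤ f G) (h : ∀ G ∈ S, 1 ≤ f G) : pr p S ≤ ex p f :=
  ex_mono h0 h1 fun G => by
    by_cases hG : G ∈ S
    · simpa [hG] using h G hG
    · simpa [hG] using hf G

lemma pr_biUnion_le {ι : Type*} {p : ℝ} (h0 : 0 ≤ p) (h1 : p ≤ 1) (I : Finset ι)
    {S : Set (SimpleGraph V)} (F : ι → Set (SimpleGraph V)) (h : ∀ G ∈ S, ∃ i ∈ I, G ∈ F i) :
    pr p S ≤ ∑ i ∈ I, pr p (F i) := by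
  simp only [pr]
  rw [← ex_sum]
  refine pr_le_ex h0 h1 (fun G => sum_nonneg fun i _ => Set.indicator_nonneg (by simp) _) ?_
  intro G hG
  obtain ⟨i, hi, hGi⟩ := h G hG
  calc (1 : ℝ) = (F i).indicator 1 G := by simp [hGi]
    _ ≤ _ := single_le_sum (f := fun i => (F i).indicator (1 : SimpleGraph V → ℝ) G)
        (fun i _ => Set.indicator_nonneg (by simp) _) hi

lemma pr_union_le {p : ℝ} (h0 : 0 ≤ p) (h1 : p ≤ 1) {S A B : Set (SimpleGraph V)}
    (h : S ⊆ A ∪ B) : pr p S ≤ pr p A + pr p B := by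
  simp only [pr]
  rw [← ex_add]
  refine ex_mono h0 h1 fun G => ?_
  by_cases hS : G ∈ S
  · rcases h hS with h' | h'
    · have : (0 : ℝ) ≤ B.indicator 1 G := Set.indicator_nonneg (by simp) _
      simp only [Set.indicator_of_mem hS, Set.indicator_of_mem h']
      simpa using this
    · have : (0 : ℝ) ≤ A.indicator 1 G := Set.indicator_nonneg (by simp) _
      simp only [Set.indicator_of_mem hS, Set.indicator_of_mem h']
      simpa using this
  · rw [Set.indicator_of_notMem hS]
    exact add_nonneg (Set.indicator_nonneg (by simp) _) (Set.indicator_nonneg (by simp) _)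

open MeasureTheory ProbabilityTheory in
-- The bridge from the measure in the theorem to the finite sums in which every estimate is made:
-- both give a graph the product of its edge weights.
lemma binomialRandom_real (p : unitInterval) (S : Set (SimpleGraph V)) :
    (SimpleGraph.binomialRandom V p).real S = pr p S := by
  set U := (pairs V).powerset.filter fun s : Finset (Sym2 V) => SimpleGraph.fromEdgeSet (s : Set (Sym2 V)) ∈ S
    with hU
  have hcoe : ((pairs V : Finset (Sym2 V)) : Set (Sym2 V)) = Sym2.diagSetᶜ := by
    ext e; simp [pairs]
  have himg : SimpleGraph.edgeSet '' S =
      ((U.image fun s : Finset (Sym2 V) => (s : Set (Sym2 V)) : Finset (Set (Sym2 V))) : Set (Set (Sym2 V))) := by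
    ext X
    simp only [hU, Set.mem_image, coe_image, coe_filter, mem_powerset, Set.mem_ofPred_eq]
    constructor
    · rintro ⟨G, hG, rfl⟩
      refine ⟨G.edgeSet.toFinset, ⟨?_, ?_⟩, by simp⟩
      · intro e he
        simpa [pairs] using G.not_isDiag_of_mem_edgeSet (by simpa using he)
      · simpa using hG
    · rintro ⟨s, ⟨hs, hsS⟩, rfl⟩
      refine ⟨_, hsS, ?_⟩
      rw [SimpleGraph.edgeSet_fromEdgeSet]
      ext e
      simp only [Set.mem_sdiff, mem_coe, Sym2.mem_diagSet, and_iff_left_iff_imp]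
      intro he
      simpa [pairs] using hs he
  rw [measureReal_def, SimpleGraph.binomialRandom_apply', himg, ← measureReal_def,
    ← sum_measureReal_singleton, sum_image (fun s _ t _ h => coe_injective h), pr, ex, exOn, hU,
    sum_filter]
  refine sum_congr rfl fun s hs => ?_
  rw [mem_powerset] at hs
  by_cases hS : SimpleGraph.fromEdgeSet (s : Set (Sym2 V)) ∈ S
  · rw [if_pos hS, Set.indicator_of_mem hS, wt_eq hs, ← hcoe,
      setBernoulli_real_singleton p (by exact_mod_cast hs) (finite_toSet _), ← coe_sdiff,
      Set.ncard_coe_finset, Set.ncard_coe_finset]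
    simp
  · rw [if_neg hS, Set.indicator_of_notMem hS, mul_zero]

/-- The moment generating function of the number of edges in a set of pairs. -/
lemma ex_exp_sum_adj {p : ℝ} (h0 : 0 ≤ p) (h1 : p ≤ 1) (θ : ℝ) (P : Finset (V × V))
    (hP : ∀ q ∈ P, q.1 ≠ q.2) (hinj : Set.InjOn (fun q : V × V => s(q.1, q.2)) P) :
    ex p (fun G => Real.exp (θ * ∑ q ∈ P, adj G q.1 q.2)) ≤
      Real.exp (p * #P * (Real.exp θ - 1)) := by
  have e1 : ∀ G : SimpleGraph V, Real.exp (θ * ∑ q ∈ P, adj G q.1 q.2) =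
      ∏ q ∈ P, Real.exp (θ * adj G q.1 q.2) := fun G => by rw [mul_sum, Real.exp_sum]
  simp only [e1]
  rw [ex_prod p P (T := fun q => {s(q.1, q.2)})
    (fun q _ => (dependsOn_adj q.1 q.2).comp fun x => Real.exp (θ * x))]
  · calc ∏ q ∈ P, ex p (fun G => Real.exp (θ * adj G q.1 q.2))
        = ∏ q ∈ P, (p * Real.exp θ + (1 - p)) := prod_congr rfl fun q hq => by
          rw [ex_comp_adj p (hP q hq) fun x => Real.exp (θ * x)]; simp
      _ ≤ ∏ q ∈ P, Real.exp (p * (Real.exp θ - 1)) := by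
          refine prod_le_prod (fun q _ => ?_) fun q _ => ?_
          · have := Real.exp_pos θ
            have : 0 ≤ p * Real.exp θ := by positivity
            linarith
          · have := Real.add_one_le_exp (p * (Real.exp θ - 1))
            linarith
      _ = _ := by
          rw [prod_const, ← Real.exp_nat_mul]
          congr 1; ring
  · intro q hq q' hq' hne e he he'
    rw [Set.mem_singleton_iff] at he he'
    exact absurd (hinj hq hq' (he.symm.trans he')) hne

/-- Markov's inequality for the exponential moment. The sign of `θ` is free: positive values give
upper tails and negative values lower tails. -/
lemma pr_chernoff {p : ℝ} (h0 : 0 ≤ p) (h1 : p ≤ 1) (θ k : ℝ) (P : Finset (V × V))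
    (hP : ∀ q ∈ P, q.1 ≠ q.2) (hinj : Set.InjOn (fun q : V × V => s(q.1, q.2)) P) :
    pr p {G | θ * k ≤ θ * ∑ q ∈ P, adj G q.1 q.2} ≤
      Real.exp (p * #P * (Real.exp θ - 1) - θ * k) := by
  have : pr p {G | θ * k ≤ θ * ∑ q ∈ P, adj G q.1 q.2} ≤
      ex p fun G => Real.exp (-(θ * k)) * Real.exp (θ * ∑ q ∈ P, adj G q.1 q.2) := by
    refine pr_le_ex h0 h1 (fun G => by positivity) fun G hG => ?_
    rw [← Real.exp_add, Real.one_le_exp_iff]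
    have : θ * k ≤ θ * ∑ q ∈ P, adj G q.1 q.2 := hG
    linarith
  refine this.trans ?_
  rw [ex_const_mul, sub_eq_neg_add, Real.exp_add]
  exact mul_le_mul_of_nonneg_left (ex_exp_sum_adj h0 h1 θ P hP hinj) (Real.exp_nonneg _)

/-- If the events `E v S` do not depend on the edges at `v`, conditioning on the neighbourhood of
`v` to be `S` does not affect them. -/
lemma pr_link_le {p β : ℝ} (h0 : 0 ≤ p) (h1 : p ≤ 1) (𝒮 : Set (Finset V))
    (E : V → Finset V → Set (SimpleGraph V))
    (hE : ∀ v S, DependsOn (fun G => G ∈ E v S) {e | v ∉ e}) (hβ0 : 0 ≤ β)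
    (hβ : ∀ v, ∀ S ∈ 𝒮, v ∉ S → pr p (E v S) ≤ β) :
    pr p {G | ∃ v, nb G v ∈ 𝒮 ∧ G ∈ E v (nb G v)} ≤ Fintype.card V * β := by
  -- The neighbourhood of `v` is decided by the pairs containing `v` and the event by the others.
  have hind : ∀ v S, pr p {G | nb G v = S ∧ G ∈ E v S} =
      pr p {G | nb G v = S} * pr p (E v S) := by
    intro v S
    simp only [pr]
    rw [← ex_mul p (T := {e | v ∈ e}) (T' := {e | v ∉ e})]
    · congr 1
      ext G
      by_cases hG : nb G v = S <;> by_cases hG' : G ∈ E v S <;> simp [Set.indicator, hG, hG']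
    · intro G G' h
      have : nb G v = nb G' v := by
        ext w
        rw [mem_nb, mem_nb]
        by_cases hvw : v = w
        · simp [hvw]
        · exact h s(v, w) (by simp) (by simpa using hvw)
      simp [Set.indicator, this]
    · intro G G' h
      have := hE v S G G' h
      simp only at this
      simp [Set.indicator, this]
    · intro e h h'; exact absurd h h'
  have hsum : ∀ v : V, ∑ S : Finset V, pr p {G | nb G v = S} = 1 := by
    intro v
    simp only [pr]
    rw [← ex_sum]
    have : (fun G : SimpleGraph V => ∑ S : Finset V,
        ({G | nb G v = S} : Set (SimpleGraph V)).indicator (1 : SimpleGraph V → ℝ) G) =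
        fun _ => 1 := by
      ext G
      rw [sum_eq_single (nb G v)] <;> simp +contextual [Set.indicator, eq_comm]
    rw [this, ex_const]
  have hterm : ∀ q : V × Finset V, pr p {G | nb G q.1 = q.2 ∧ q.2 ∈ 𝒮 ∧ G ∈ E q.1 q.2} ≤
      pr p {G | nb G q.1 = q.2} * β := by
    rintro ⟨v, S⟩
    simp only
    have hnn := pr_nonneg h0 h1 {G : SimpleGraph V | nb G v = S}
    by_cases hS : S ∈ 𝒮 ∧ v ∉ S
    · refine (pr_mono h0 h1 (S' := {G | nb G v = S ∧ G ∈ E v S}) fun G hG =>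
        ⟨hG.1, hG.2.2⟩).trans ?_
      rw [hind]
      exact mul_le_mul_of_nonneg_left (hβ v S hS.1 hS.2) hnn
    · have : {G : SimpleGraph V | nb G v = S ∧ S ∈ 𝒮 ∧ G ∈ E v S} = ∅ := by
        rw [Set.eq_empty_iff_forall_notMem]
        rintro G ⟨rfl, h2, -⟩
        exact hS ⟨h2, by simp [mem_nb]⟩
      rw [this]
      have : pr p (∅ : Set (SimpleGraph V)) = 0 := by
        simp only [pr, Set.indicator_empty]; exact ex_const p 0
      rw [this]
      positivity
  calc _ ≤ ∑ q : V × Finset V, pr p {G | nb G q.1 = q.2 ∧ q.2 ∈ 𝒮 ∧ G ∈ E q.1 q.2} := by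
        refine pr_biUnion_le h0 h1 univ _ fun G hG => ?_
        obtain ⟨v, hv, hG⟩ := hG
        exact ⟨(v, nb G v), mem_univ _, rfl, hv, hG⟩
    _ ≤ ∑ q : V × Finset V, pr p {G | nb G q.1 = q.2} * β := sum_le_sum fun q _ => hterm q
    _ = _ := by
        rw [← sum_mul, ← univ_product_univ, sum_product]
        simp [hsum]

end Percolation
-- Above the threshold: each regularity property holds with high probability.
section Dense
open Finset
open scoped Classical

variable {V : Type*} [Fintype V]

lemma exp_sub_one_le {θ : ℝ} (h : |θ| ≤ 1) : Real.exp θ - 1 ≤ θ + θ ^ 2 := by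
  have := (abs_le.1 (Real.abs_exp_sub_one_sub_id_le h)).2
  linarith

lemma pr_le_sum_adj {p : ℝ} (h0 : 0 ≤ p) (h1 : p ≤ 1) {θ k μ : ℝ} (hθ : 0 < θ) (hθ1 : θ ≤ 1)
    (P : Finset (V × V)) (hP : ∀ q ∈ P, q.1 ≠ q.2)
    (hinj : Set.InjOn (fun q : V × V => s(q.1, q.2)) P) (hμ : p * #P ≤ μ) :
    pr p {G | k ≤ ∑ q ∈ P, adj G q.1 q.2} ≤ Real.exp (μ * (θ + θ ^ 2) - θ * k) := by
  have h2 := pr_chernoff h0 h1 θ k P hP hinj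
  have h3 : {G | θ * k ≤ θ * ∑ q ∈ P, adj G q.1 q.2} = {G | k ≤ ∑ q ∈ P, adj G q.1 q.2} := by
    ext G; simp [mul_le_mul_iff_right₀ hθ]
  rw [h3] at h2
  refine h2.trans (Real.exp_le_exp.2 (sub_le_sub_right ?_ _))
  have h4 := exp_sub_one_le (θ := θ) (by rw [abs_of_pos hθ]; exact hθ1)
  exact mul_le_mul hμ h4 (by simpa using hθ.le) ((by positivity : 0 ≤ p * #P).trans hμ)

lemma pr_sum_adj_le {p : ℝ} (h0 : 0 ≤ p) (h1 : p ≤ 1) {θ k μ : ℝ} (hθ : 0 < θ) (hθ1 : θ ≤ 1)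
    (P : Finset (V × V)) (hP : ∀ q ∈ P, q.1 ≠ q.2)
    (hinj : Set.InjOn (fun q : V × V => s(q.1, q.2)) P) (hμ : μ ≤ p * #P) :
    pr p {G | ∑ q ∈ P, adj G q.1 q.2 ≤ k} ≤ Real.exp (μ * (-θ + θ ^ 2) + θ * k) := by
  have h2 := pr_chernoff h0 h1 (-θ) k P hP hinj
  have h3 : {G | -θ * k ≤ -θ * ∑ q ∈ P, adj G q.1 q.2} = {G | ∑ q ∈ P, adj G q.1 q.2 ≤ k} := by
    ext G; simp [mul_le_mul_iff_right₀ hθ]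
  rw [h3] at h2
  refine h2.trans (Real.exp_le_exp.2 ?_)
  have h4 := exp_sub_one_le (θ := -θ) (by rw [abs_neg, abs_of_pos hθ]; exact hθ1)
  have h5 : p * #P * (Real.exp (-θ) - 1) ≤ p * #P * (-θ + θ ^ 2) :=
    mul_le_mul_of_nonneg_left (by linarith) (by positivity)
  have h6 : p * #P * (-θ + θ ^ 2) ≤ μ * (-θ + θ ^ 2) :=
    mul_le_mul_of_nonpos_right hμ (by nlinarith)
  linarith

lemma injOn_mk_product {A B : Finset V} (h : Disjoint A B) :
    Set.InjOn (fun q : V × V => s(q.1, q.2)) (A ×ˢ B : Finset (V × V)) := by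
  rintro ⟨a, b⟩ h1 ⟨c, d⟩ h2 h3
  simp only [coe_product, Set.mem_prod, mem_coe] at h1 h2
  simp only [Sym2.eq_iff] at h3
  rcases h3 with ⟨rfl, rfl⟩ | ⟨rfl, rfl⟩
  · rfl
  · exact absurd h2.2 (disjoint_left.1 h h1.1)

lemma ne_of_mem_product {A B : Finset V} (h : Disjoint A B) :
    ∀ q ∈ A ×ˢ B, q.1 ≠ q.2 := by
  rintro ⟨a, b⟩ h1 h2
  simp only [mem_product] at h1 h2
  exact disjoint_left.1 h h1.1 (h2 ▸ h1.2)

lemma e2_eq_sum_product (G : SimpleGraph V) (A B : Finset V) :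
    e2 G A B = ∑ q ∈ A ×ˢ B, adj G q.1 q.2 := by
  rw [e2, sum_product]

/-- The pairs of elements of `A`, each taken in one order. -/
noncomputable def upper (A : Finset V) : Finset (V × V) :=
  (A ×ˢ A).filter fun q => Fintype.equivFin V q.1 < Fintype.equivFin V q.2

lemma sum_product_self_eq (A : Finset V) (F : V → V → ℝ) (hF : ∀ a b, F a b = F b a)
    (hF0 : ∀ a, F a a = 0) : ∑ q ∈ A ×ˢ A, F q.1 q.2 = 2 * ∑ q ∈ upper A, F q.1 q.2 := by
  have h1 : ∑ q ∈ (A ×ˢ A).filter fun q => ¬ Fintype.equivFin V q.1 < Fintype.equivFin V q.2,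
      F q.1 q.2 = ∑ q ∈ upper A, F q.1 q.2 := by
    rw [upper, sum_filter, sum_filter]
    refine sum_nbij' Prod.swap Prod.swap ?_ ?_ ?_ ?_ ?_
    · rintro ⟨a, b⟩; simp [and_comm]
    · rintro ⟨a, b⟩; simp [and_comm]
    · simp
    · simp
    · rintro ⟨a, b⟩ _
      simp only [Prod.fst_swap, Prod.snd_swap, not_lt]
      rcases lt_trichotomy (Fintype.equivFin V a) (Fintype.equivFin V b) with h | h | h
      · rw [if_neg (not_le.2 h), if_neg (not_lt.2 h.le)]
      · obtain rfl := (Fintype.equivFin V).injective h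
        simp [hF0]
      · rw [if_pos h.le, if_pos h, hF]
  rw [← sum_filter_add_sum_filter_not (A ×ˢ A)
    (fun q => Fintype.equivFin V q.1 < Fintype.equivFin V q.2), h1, upper]
  ring

/-- Ordered pairs count every edge twice; the Chernoff bounds need each edge variable once. -/
lemma e2_self_eq (G : SimpleGraph V) (A : Finset V) :
    e2 G A A = 2 * ∑ q ∈ upper A, adj G q.1 q.2 := by
  rw [e2_eq_sum_product]
  exact sum_product_self_eq A (adj G) (adj_comm G) (by simp [adj])

lemma ne_of_mem_upper {A : Finset V} : ∀ q ∈ upper A, q.1 ≠ q.2 := by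
  rintro q hq h
  simp [upper, h] at hq

lemma card_upper_le (A : Finset V) : 2 * (#(upper A) : ℝ) ≤ (#A : ℝ) ^ 2 := by
  have h := sum_product_self_eq A (fun a b => if a = b then 0 else 1)
    (fun a b => by simp [eq_comm]) (by simp)
  have h1 : ∑ q ∈ upper A, (if q.1 = q.2 then (0 : ℝ) else 1) = #(upper A) := by
    rw [sum_congr rfl fun q hq => if_neg (ne_of_mem_upper q hq)]; simp
  rw [← h1, ← h]
  calc _ ≤ ∑ q ∈ A ×ˢ A, (1 : ℝ) := sum_le_sum fun q _ => by split_ifs <;> norm_num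
    _ = _ := by simp [sq]

lemma injOn_mk_upper (A : Finset V) :
    Set.InjOn (fun q : V × V => s(q.1, q.2)) (upper A) := by
  rintro ⟨a, b⟩ h1 ⟨c, d⟩ h2 h3
  simp only [upper, coe_filter, mem_product, Set.mem_ofPred_eq] at h1 h2
  simp only [Sym2.eq_iff] at h3
  rcases h3 with ⟨rfl, rfl⟩ | ⟨rfl, rfl⟩
  · rfl
  · exact absurd h1.2 (not_lt.2 h2.2.le)

lemma dependsOn_e2 {A B S : Finset V} (hA : A ⊆ S) (hB : B ⊆ S) {v : V} (hv : v ∉ S)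
    {G G' : SimpleGraph V}
    (h : ∀ e ∈ {e : Sym2 V | v ∉ e}, ¬ e.IsDiag → (e ∈ G.edgeSet ↔ e ∈ G'.edgeSet)) :
    e2 G A B = e2 G' A B := by
  refine sum_congr rfl fun a ha => sum_congr rfl fun b hb => ?_
  refine dependsOn_adj a b G G' fun e he => h e ?_
  rw [Set.mem_singleton_iff] at he
  subst he
  simp only [Set.mem_ofPred_eq, Sym2.mem_iff, not_or]
  exact ⟨fun h => hv (h ▸ hA ha), fun h => hv (h ▸ hB hb)⟩

lemma card_nb_eq_sum (G : SimpleGraph V) (v : V) :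
    (#(nb G v) : ℝ) = ∑ q ∈ {v} ×ˢ univ.erase v, adj G q.1 q.2 := by
  rw [sum_product, sum_singleton, card_nb, ← add_sum_erase _ _ (mem_univ v)]
  simp [adj]

variable {p : ℝ}

lemma pr_deg_lt_le (h0 : 0 ≤ p) (h1 : p ≤ 1) {ε : ℝ} (hε : 0 < ε) (hε1 : ε ≤ 1) (v : V) :
    pr p {G | (#(nb G v) : ℝ) ≤ (1 - ε) * (Fintype.card V * p)} ≤
      Real.exp (1 - ε ^ 2 / 4 * (Fintype.card V * p)) := by
  have hd : Disjoint {v} (univ.erase v) := by simp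
  simp only [card_nb_eq_sum]
  -- There are only `n - 1` possible neighbours, and `p(n - 1) ≥ np - 1`.
  refine (pr_sum_adj_le h0 h1 (θ := ε / 2) (μ := Fintype.card V * p - 1) (by positivity)
    (by linarith) _ (ne_of_mem_product hd) (injOn_mk_product hd) ?_).trans ?_
  · rw [card_product, card_singleton, one_mul, card_erase_of_mem (mem_univ v), card_univ,
      Nat.cast_sub (Fintype.card_pos_iff.2 ⟨v⟩)]
    push_cast
    nlinarith
  · rw [Real.exp_le_exp]
    nlinarith

lemma pr_lt_deg_le (h0 : 0 ≤ p) (h1 : p ≤ 1) {ε : ℝ} (hε : 0 < ε) (hε1 : ε ≤ 1) (v : V) :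
    pr p {G | (1 + ε) * (Fintype.card V * p) ≤ (#(nb G v) : ℝ)} ≤
      Real.exp (1 - ε ^ 2 / 4 * (Fintype.card V * p)) := by
  have hd : Disjoint {v} (univ.erase v) := by simp
  simp only [card_nb_eq_sum]
  refine (pr_le_sum_adj h0 h1 (θ := ε / 2) (μ := Fintype.card V * p) (by positivity)
    (by linarith) _ (ne_of_mem_product hd) (injOn_mk_product hd) ?_).trans ?_
  · rw [card_product, card_singleton, one_mul, card_erase_of_mem (mem_univ v), card_univ,
      Nat.cast_sub (Fintype.card_pos_iff.2 ⟨v⟩)]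
    push_cast
    nlinarith
  · rw [Real.exp_le_exp]
    nlinarith

/-- Small sets are sparse by a Chernoff bound with the large parameter `6 / ε`: the size restriction
cancels `exp (6 / ε)` in the moment term, which is then at most `L#A/2`, against a gain of `3L#A`.
The resulting `exp (-(5/2)L)` per vertex beats the union over all sets. -/
lemma pr_light_le (h0 : 0 ≤ p) (h1 : p ≤ 1) {ε L : ℝ} (hε : 0 < ε)
    (hL : L = Fintype.card V * p ^ 2) (hLn : 5 / 4 * Real.log (Fintype.card V) ≤ L)
    (hn : 2 ≤ Fintype.card V) :
    pr p {G | ∃ A : Finset V, #A ≤ Real.exp (-(6 / ε)) * (Fintype.card V * p) ∧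
      ε * L * #A < e2 G A A} ≤ 2 / Fintype.card V := by
  have hn0 : (0 : ℝ) < Fintype.card V := by positivity
  have hA : ∀ A : Finset V, #A ≤ Real.exp (-(6 / ε)) * (Fintype.card V * p) →
      pr p {G | ε * L * #A < e2 G A A} ≤ Real.exp (-(5 / 2 * L)) ^ #A := by
    intro A hA
    have h2 := pr_chernoff h0 h1 (6 / ε) (ε * L * #A / 2) _ ne_of_mem_upper (injOn_mk_upper A)
    refine (pr_mono h0 h1 fun G hG => ?_).trans (h2.trans ?_)
    · have : ε * L * #A < e2 G A A := hG
      rw [e2_self_eq] at this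
      exact mul_le_mul_of_nonneg_left (by linarith) (show 0 ≤ 6 / ε by positivity)
    · rw [← Real.exp_nat_mul, Real.exp_le_exp]
      have h3 : p * #(upper A) * (Real.exp (6 / ε) - 1) ≤ L * #A / 2 := by
        have h4 : p * #(upper A) * (Real.exp (6 / ε) - 1) ≤
            p * ((#A : ℝ) * (Real.exp (-(6 / ε)) * (Fintype.card V * p)) / 2) *
              Real.exp (6 / ε) := by
          have h6 : (#A : ℝ) ^ 2 ≤ #A * (Real.exp (-(6 / ε)) * (Fintype.card V * p)) := by
            rw [sq]; gcongr
          have h7 := card_upper_le A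
          have h8 : (1 : ℝ) ≤ Real.exp (6 / ε) := Real.one_le_exp (by positivity)
          gcongr <;> linarith
        have h5 : p * ((#A : ℝ) * (Real.exp (-(6 / ε)) * (Fintype.card V * p)) / 2) *
              Real.exp (6 / ε) = L * #A / 2 := by
          rw [Real.exp_neg, hL]; field_simp
        linarith
      have h4 : 6 / ε * (ε * L * #A / 2) = 3 * L * #A := by field_simp; ring
      rw [h4]; linarith
  set x := Real.exp (-(5 / 2 * L)) with hx
  have hx0 : 0 < x := Real.exp_pos _
  have hxn : x ≤ 1 / (Fintype.card V : ℝ) ^ 2 := by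
    rw [one_div, ← Real.exp_log (inv_pos.2 (pow_pos hn0 2)), hx, Real.exp_le_exp, Real.log_inv,
      Real.log_pow]
    have : 0 ≤ Real.log (Fintype.card V) := Real.log_nonneg (by exact_mod_cast by omega)
    push_cast; linarith
  have hnx : Fintype.card V * x ≤ 1 / Fintype.card V := by
    calc Fintype.card V * x ≤ Fintype.card V * (1 / (Fintype.card V : ℝ) ^ 2) := by gcongr
      _ = _ := by field_simp
  -- The empty set, where the event is impossible, must be left out: its term would be 1, whereas
  -- the rest sums to `(1 + x)^n - 1`, of order `nx`.
  have hsum : 1 + ∑ A ∈ (univ : Finset (Finset V)).erase ∅, x ^ #A = (1 + x) ^ Fintype.card V := by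
    have := prod_one_add (f := fun _ : V => x) univ
    simp only [prod_const, powerset_univ, card_univ] at this
    rw [this, ← add_sum_erase _ _ (mem_univ ∅)]; simp
  have hexp : (1 + x) ^ Fintype.card V ≤ Real.exp (Fintype.card V * x) := by
    rw [Real.exp_nat_mul]
    have := Real.add_one_le_exp x
    gcongr; linarith
  have hfin : Real.exp (Fintype.card V * x) - 1 ≤ 2 * (Fintype.card V * x) := by
    have h2 : |(Fintype.card V : ℝ) * x| ≤ 1 := by
      rw [abs_of_pos (by positivity)]
      refine hnx.trans ?_
      rw [div_le_one hn0]; exact_mod_cast by omega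
    have := (abs_le.1 (Real.abs_exp_sub_one_le h2)).2
    rwa [abs_of_pos (by positivity)] at this
  calc _ ≤ ∑ A ∈ (univ : Finset (Finset V)).erase ∅,
        pr p {G | #A ≤ Real.exp (-(6 / ε)) * (Fintype.card V * p) ∧ ε * L * #A < e2 G A A} := by
        refine pr_biUnion_le h0 h1 _ _ fun G hG => ?_
        obtain ⟨A, hA1, hA2⟩ := hG
        refine ⟨A, mem_erase.2 ⟨?_, mem_univ _⟩, hA1, hA2⟩
        rintro rfl
        simp [e2] at hA2
    _ ≤ ∑ A ∈ (univ : Finset (Finset V)).erase ∅, x ^ #A := by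
        refine sum_le_sum fun A _ => ?_
        by_cases hA1 : #A ≤ Real.exp (-(6 / ε)) * (Fintype.card V * p)
        · exact (pr_mono h0 h1 fun G hG => hG.2).trans (hA A hA1)
        · have : {G : SimpleGraph V | #A ≤ Real.exp (-(6 / ε)) * (Fintype.card V * p) ∧
              ε * L * #A < e2 G A A} = ∅ := by
            ext G; simp [hA1]
          rw [this, pr, Set.indicator_empty]
          exact (ex_const p 0).trans_le (by positivity)
    _ ≤ 2 * (Fintype.card V * x) := by linarith
    _ ≤ 2 * (1 / Fintype.card V) := by gcongr
    _ = _ := by ring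

lemma two_pow_le_exp (k : ℕ) : (2 : ℝ) ^ k ≤ Real.exp k := by
  have h : (2 : ℝ) ≤ Real.exp 1 := by have := Real.add_one_le_exp (1 : ℝ); linarith
  calc (2 : ℝ) ^ k ≤ Real.exp 1 ^ k := by gcongr
    _ = _ := by rw [← Real.exp_nat_mul, mul_one]

/-- Given the neighbourhood `S` of `v`, the edges inside `S` are still independent. With `θ = ε / 4`
a fixed set fails with probability at most `exp (-(ε²/16)L#A) ≤ exp (-6m)`, against at most `exp
(2m)` subsets. -/
lemma pr_inner_le (h0 : 0 ≤ p) (h1 : p ≤ 1) {ε κ L m : ℝ} (hε : 0 < ε) (hε1 : ε ≤ 1)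
    (hm : m = Fintype.card V * p) (hL : L = m * p) (hκL : 6 ≤ ε ^ 2 / 16 * κ * L) :
    pr p {G : SimpleGraph V | ∃ v, #(nb G v) ≤ 2 * m ∧ ∃ A ⊆ nb G v, κ * m ≤ #A ∧
      p * #A ^ 2 + ε * L * #A < e2 G A A} ≤ Fintype.card V * Real.exp (-m) := by
  have hm0 : 0 ≤ m := by rw [hm]; positivity
  have hL0 : 0 ≤ L := by rw [hL]; positivity
  have hE := pr_link_le (V := V) (β := Real.exp (-m)) h0 h1 {S | (#S : ℝ) ≤ 2 * m}
    (fun v S => {G | v ∉ S ∧ ∃ A ⊆ S, κ * m ≤ #A ∧ p * #A ^ 2 + ε * L * #A < e2 G A A})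
    ?_ (Real.exp_nonneg _) ?_
  · refine (pr_mono h0 h1 fun G hG => ?_).trans hE
    obtain ⟨v, hv, hA⟩ := hG
    exact ⟨v, hv, by simp [mem_nb], hA⟩
  · intro v S G G' h
    simp only [Set.mem_ofPred_eq, eq_iff_iff]
    refine and_congr_right fun hv => exists_congr fun A => and_congr_right fun hA => ?_
    rw [dependsOn_e2 hA hA hv h]
  · intro v S hS hv
    have hS' : (#S : ℝ) ≤ 2 * m := hS
    have hA : ∀ A ∈ S.powerset, pr p {G | κ * m ≤ #A ∧ p * #A ^ 2 + ε * L * #A < e2 G A A} ≤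
        Real.exp (-(6 * m)) := by
      intro A hA
      by_cases hA1 : κ * m ≤ #A
      · have hAm : (#A : ℝ) ≤ 2 * m :=
          le_trans (by exact_mod_cast card_le_card (mem_powerset.1 hA)) hS'
        have hμ : p * #A ^ 2 / 2 ≤ L * #A := by
          have := mul_le_mul_of_nonneg_left hAm (show 0 ≤ p * #A by positivity)
          rw [hL]; nlinarith
        have h2 := pr_le_sum_adj h0 h1 (θ := ε / 4) (k := (p * #A ^ 2 + ε * L * #A) / 2)
          (μ := p * #A ^ 2 / 2) (by positivity) (by linarith) _ ne_of_mem_upper (injOn_mk_upper A)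
          (by have := mul_le_mul_of_nonneg_left (card_upper_le A) h0; linarith)
        refine (pr_mono h0 h1 fun G hG => ?_).trans (h2.trans ?_)
        · have h3 := hG.2
          rw [e2_self_eq] at h3
          simp only [Set.mem_ofPred_eq]; linarith
        · rw [Real.exp_le_exp]
          have h3 : p * #A ^ 2 / 2 * (ε / 4) ^ 2 ≤ L * #A * (ε / 4) ^ 2 := by gcongr
          have h4 : ε ^ 2 / 16 * L * (κ * m) ≤ ε ^ 2 / 16 * L * #A := by gcongr
          have h5 := mul_le_mul_of_nonneg_right hκL hm0
          linarith
      · have : {G : SimpleGraph V | κ * m ≤ #A ∧ p * #A ^ 2 + ε * L * #A < e2 G A A} = ∅ := by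
          ext G; simp [hA1]
        rw [this, pr, Set.indicator_empty]
        exact (ex_const p 0).trans_le (by positivity)
    calc _ ≤ ∑ A ∈ S.powerset, pr p {G | κ * m ≤ #A ∧ p * #A ^ 2 + ε * L * #A < e2 G A A} := by
          refine pr_biUnion_le h0 h1 _ _ fun G hG => ?_
          obtain ⟨-, A, hA, hA2⟩ := hG
          exact ⟨A, mem_powerset.2 hA, hA2⟩
      _ ≤ ∑ A ∈ S.powerset, Real.exp (-(6 * m)) := sum_le_sum hA
      _ = 2 ^ #S * Real.exp (-(6 * m)) := by simp
      _ ≤ Real.exp #S * Real.exp (-(6 * m)) := by gcongr; exact two_pow_le_exp _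
      _ ≤ Real.exp (-m) := by
          rw [← Real.exp_add, Real.exp_le_exp]; linarith

/-- The argument for inner edges with lower tails; pairs of subsets cost `exp (4m)`, still less than
`exp (6m)`. -/
lemma pr_cross_le (h0 : 0 ≤ p) (h1 : p ≤ 1) {ε κ L m : ℝ} (hε : 0 < ε) (hε1 : ε ≤ 1)
    (hm : m = Fintype.card V * p) (hL : L = m * p) (hκL : 6 ≤ ε ^ 2 / 16 * κ * L) :
    pr p {G : SimpleGraph V | ∃ v, #(nb G v) ≤ 2 * m ∧ ∃ A ⊆ nb G v, ∃ B ⊆ nb G v, Disjoint A B ∧ κ * m ≤ #A ∧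
      e2 G A B < p * #A * #B - ε * L * #A} ≤ Fintype.card V * Real.exp (-m) := by
  have hm0 : 0 ≤ m := by rw [hm]; positivity
  have hL0 : 0 ≤ L := by rw [hL]; positivity
  have hE := pr_link_le (V := V) (β := Real.exp (-m)) h0 h1 {S | (#S : ℝ) ≤ 2 * m}
    (fun v S => {G | v ∉ S ∧ ∃ A ⊆ S, ∃ B ⊆ S, Disjoint A B ∧ κ * m ≤ #A ∧
      e2 G A B < p * #A * #B - ε * L * #A})
    ?_ (Real.exp_nonneg _) ?_
  · refine (pr_mono h0 h1 fun G hG => ?_).trans hE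
    obtain ⟨v, hv, hA⟩ := hG
    exact ⟨v, hv, by simp [mem_nb], hA⟩
  · intro v S G G' h
    simp only [Set.mem_ofPred_eq, eq_iff_iff]
    refine and_congr_right fun hv => exists_congr fun A => and_congr_right fun hA =>
      exists_congr fun B => and_congr_right fun hB => ?_
    rw [dependsOn_e2 hA hB hv h]
  · intro v S hS hv
    have hS' : (#S : ℝ) ≤ 2 * m := hS
    have hA : ∀ q ∈ S.powerset ×ˢ S.powerset, pr p {G | Disjoint q.1 q.2 ∧ κ * m ≤ #q.1 ∧
        e2 G q.1 q.2 < p * #q.1 * #q.2 - ε * L * #q.1} ≤ Real.exp (-(6 * m)) := by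
      rintro ⟨A, B⟩ hAB
      simp only [mem_product, mem_powerset] at hAB ⊢
      by_cases hA1 : Disjoint A B ∧ κ * m ≤ #A
      · have hBm : (#B : ℝ) ≤ 2 * m :=
          le_trans (by exact_mod_cast card_le_card hAB.2) hS'
        have hμ : p * #A * #B ≤ 2 * L * #A := by
          have := mul_le_mul_of_nonneg_left hBm (show 0 ≤ p * #A by positivity)
          rw [hL]; linarith
        have h2 := pr_sum_adj_le h0 h1 (θ := ε / 4) (k := p * #A * #B - ε * L * #A)
          (μ := p * #A * #B) (by positivity) (by linarith) _ (ne_of_mem_product hA1.1)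
          (injOn_mk_product hA1.1) (by rw [card_product]; push_cast; linarith)
        refine (pr_mono h0 h1 fun G hG => ?_).trans (h2.trans ?_)
        · have h3 := hG.2.2
          rw [e2_eq_sum_product] at h3
          simp only [Set.mem_ofPred_eq]; linarith
        · rw [Real.exp_le_exp]
          have h3 : p * #A * #B * (ε / 4) ^ 2 ≤ 2 * L * #A * (ε / 4) ^ 2 := by gcongr
          have h4 : ε ^ 2 / 16 * L * (κ * m) ≤ ε ^ 2 / 16 * L * #A :=
            mul_le_mul_of_nonneg_left hA1.2 (by positivity)
          have h5 := mul_le_mul_of_nonneg_right hκL hm0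
          have h6 : 0 ≤ ε ^ 2 / 16 * L * #A := by positivity
          linarith
      · have : {G : SimpleGraph V | Disjoint A B ∧ κ * m ≤ #A ∧
            e2 G A B < p * #A * #B - ε * L * #A} = ∅ := by
          ext G
          simp only [Set.mem_ofPred_eq, Set.mem_empty_iff_false, iff_false]
          exact fun h => hA1 ⟨h.1, h.2.1⟩
        rw [this, pr, Set.indicator_empty]
        exact (ex_const p 0).trans_le (by positivity)
    calc _ ≤ ∑ q ∈ S.powerset ×ˢ S.powerset, pr p {G | Disjoint q.1 q.2 ∧ κ * m ≤ #q.1 ∧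
          e2 G q.1 q.2 < p * #q.1 * #q.2 - ε * L * #q.1} := by
          refine pr_biUnion_le h0 h1 _ _ fun G hG => ?_
          obtain ⟨-, A, hA, B, hB, hAB⟩ := hG
          exact ⟨(A, B), by simp [hA, hB], hAB⟩
      _ ≤ ∑ q ∈ S.powerset ×ˢ S.powerset, Real.exp (-(6 * m)) := sum_le_sum hA
      _ = 2 ^ #S * 2 ^ #S * Real.exp (-(6 * m)) := by simp
      _ ≤ Real.exp #S * Real.exp #S * Real.exp (-(6 * m)) := by
          gcongr <;> exact two_pow_le_exp _
      _ ≤ Real.exp (-m) := by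
          rw [← Real.exp_add, ← Real.exp_add, Real.exp_le_exp]; linarith

/-- Given the neighbourhood `S` of `v`, codegrees with `v` are degrees into `S`. Two small ones
leave at most `L / 50` edges from `{a, b}` to the rest of `S`, where about `2L` are expected. The
pair `ab` is dropped to keep the edge variables distinct. -/
lemma pr_codeg_le (h0 : 0 ≤ p) (h1 : p ≤ 1) {L m : ℝ}
    (hm : m = Fintype.card V * p) (hL : L = m * p) :
    pr p {G : SimpleGraph V | ∃ v, (199 / 200 * m ≤ #(nb G v) ∧ #(nb G v) ≤ 2 * m) ∧
      ∃ a b, a ∈ nb G v ∧ b ∈ nb G v ∧ a ≠ b ∧ codeg G v a < L / 100 ∧ codeg G v b < L / 100} ≤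
      Fintype.card V * ((2 * m) ^ 2 * Real.exp (4 - 9 / 5 * L)) := by
  have hm0 : 0 ≤ m := by rw [hm]; positivity
  have hL0 : 0 ≤ L := by rw [hL]; positivity
  have hE := pr_link_le (V := V) (β := (2 * m) ^ 2 * Real.exp (4 - 9 / 5 * L)) h0 h1
    {S | 199 / 200 * m ≤ #S ∧ #S ≤ 2 * m}
    (fun v S => {G | v ∉ S ∧ ∃ q ∈ S ×ˢ S, q.1 ≠ q.2 ∧ e2 G {q.1, q.2} (S \ {q.1, q.2}) ≤ L / 50})
    ?_ (by positivity) ?_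
  · refine (pr_mono h0 h1 fun G hG => ?_).trans hE
    obtain ⟨v, hv, a, b, ha, hb, hab, hca, hcb⟩ := hG
    refine ⟨v, hv, by simp [mem_nb], (a, b), by simp [ha, hb], hab, ?_⟩
    have h3 : ∀ a (T : Finset V), ∑ x ∈ nb G v \ T, adj G a x ≤ codeg G v a := fun a T => by
      rw [codeg, ← sum_nb]
      exact sum_le_sum_of_subset_of_nonneg sdiff_subset fun _ _ _ => adj_nonneg ..
    simp only [e2]
    rw [sum_pair hab]
    linarith [h3 a {a, b}, h3 b {a, b}]
  · intro v S G G' h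
    simp only [Set.mem_ofPred_eq, eq_iff_iff]
    refine and_congr_right fun hv => exists_congr fun q => and_congr_right fun hq => ?_
    rw [mem_product] at hq
    rw [dependsOn_e2 (insert_subset hq.1 (singleton_subset_iff.2 hq.2)) sdiff_subset hv h]
  · intro v S hS hv
    have hA : ∀ q ∈ S ×ˢ S, pr p {G | q.1 ≠ q.2 ∧ e2 G {q.1, q.2} (S \ {q.1, q.2}) ≤ L / 50} ≤
        Real.exp (4 - 9 / 5 * L) := by
      rintro ⟨a, b⟩ hq
      simp only [mem_product] at hq ⊢
      by_cases hab : a ≠ b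
      · have hd : Disjoint {a, b} (S \ {a, b}) := disjoint_sdiff
        -- With `exp (-4) ≤ 1/50` the exponent is at most `-(49/50)(1.99L - 4) + 4L/50`, which is
        -- below `4 - (9/5)L`.
        have h2 := pr_chernoff h0 h1 (-4) (L / 50) _ (ne_of_mem_product hd) (injOn_mk_product hd)
        refine (pr_mono h0 h1 fun G hG => ?_).trans (h2.trans ?_)
        · have h3 := hG.2
          rw [e2_eq_sum_product] at h3
          simp only [Set.mem_ofPred_eq]; linarith
        · rw [Real.exp_le_exp]
          have hsub : {a, b} ⊆ S := insert_subset hq.1 (singleton_subset_iff.2 hq.2)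
          have hc : (#({a, b} ×ˢ (S \ {a, b})) : ℝ) = 2 * (#S - 2) := by
            rw [card_product, card_pair hab, card_sdiff_of_subset hsub, card_pair hab]
            have : 2 ≤ #S := by rw [← card_pair hab]; exact card_le_card hsub
            push_cast [Nat.cast_sub this]; ring
          have he : Real.exp (-4) ≤ 1 / 50 := by
            rw [show (-4 : ℝ) = (4 : ℕ) * (-1) by norm_num, Real.exp_nat_mul]
            have := Real.exp_neg_one_lt_d9
            have h9 : Real.exp (-1) ≤ 0.3679 := by linarith
            calc Real.exp (-1) ^ 4 ≤ 0.3679 ^ 4 := by gcongr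
              _ ≤ _ := by norm_num
          rw [hc]
          have h4 : p * (199 / 200 * m) ≤ p * #S := mul_le_mul_of_nonneg_left hS.1 h0
          have h5 : 199 / 100 * L - 4 ≤ p * (2 * (#S - 2)) := by rw [hL]; linarith
          have h6 : p * (2 * (#S - 2)) * (Real.exp (-4) - 1) ≤
              p * (2 * (#S - 2)) * (-(49 / 50)) := by
            refine mul_le_mul_of_nonneg_left (by linarith) ?_
            refine mul_nonneg h0 ?_
            rw [← hc]; positivity
          linarith
      · have : {G : SimpleGraph V | a ≠ b ∧ e2 G {a, b} (S \ {a, b}) ≤ L / 50} = ∅ := by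
          ext G; simp [hab]
        rw [this, pr, Set.indicator_empty]
        exact (ex_const p 0).trans_le (by positivity)
    calc _ ≤ ∑ q ∈ S ×ˢ S, pr p {G | q.1 ≠ q.2 ∧ e2 G {q.1, q.2} (S \ {q.1, q.2}) ≤ L / 50} := by
          refine pr_biUnion_le h0 h1 _ _ fun G hG => ?_
          obtain ⟨-, q, hq, hq2⟩ := hG
          exact ⟨q, hq, hq2⟩
      _ ≤ ∑ q ∈ S ×ˢ S, Real.exp (4 - 9 / 5 * L) := sum_le_sum hA
      _ = (#S : ℝ) ^ 2 * Real.exp (4 - 9 / 5 * L) := by simp [sq]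
      _ ≤ _ := by gcongr; exact hS.2

/-- The mean is at least `ηLn/8`, so halving it has probability at most `exp (-ηLn/128) ≤ exp
(-3n)`, enough for the at most `exp (2n)` pairs of sets. -/
lemma pr_expand_le (h0 : 0 ≤ p) (h1 : p ≤ 1) {η L m : ℝ} (hη : 0 < η)
    (hm : m = Fintype.card V * p) (hL : L = m * p) (hηL : 3 ≤ η * L / 128) :
    pr p {G : SimpleGraph V | ∃ W X : Finset V, Disjoint W X ∧ m / 4 ≤ #W ∧
      η * Fintype.card V / 2 ≤ #X ∧ e2 G W X < p * #W * #X / 2} ≤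
      Real.exp (-Fintype.card V) := by
  have hm0 : 0 ≤ m := by rw [hm]; positivity
  have hA : ∀ q : Finset V × Finset V, pr p {G : SimpleGraph V | Disjoint q.1 q.2 ∧
      m / 4 ≤ #q.1 ∧ η * Fintype.card V / 2 ≤ #q.2 ∧ e2 G q.1 q.2 < p * #q.1 * #q.2 / 2} ≤
      Real.exp (-(3 * Fintype.card V)) := by
    rintro ⟨W, X⟩
    simp only
    by_cases hWX : Disjoint W X ∧ m / 4 ≤ #W ∧ η * Fintype.card V / 2 ≤ #X
    · obtain ⟨hd, hW, hX⟩ := hWX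
      have h2 := pr_sum_adj_le h0 h1 (θ := 1 / 4) (k := p * #W * #X / 2)
          (μ := p * #W * #X) (by positivity) (by norm_num) _ (ne_of_mem_product hd)
          (injOn_mk_product hd) (by rw [card_product]; push_cast; linarith)
      refine (pr_mono h0 h1 fun G hG => ?_).trans (h2.trans ?_)
      · have h3 := hG.2.2.2
        rw [e2_eq_sum_product] at h3
        simp only [Set.mem_ofPred_eq]; linarith
      · rw [Real.exp_le_exp]
        have h3 : p * (m / 4) * (η * Fintype.card V / 2) ≤ p * #W * #X := by gcongr
        have h4 := mul_le_mul_of_nonneg_right hηL (Nat.cast_nonneg (α := ℝ) (Fintype.card V))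
        rw [hL] at h4
        linarith
    · have : {G : SimpleGraph V | Disjoint W X ∧ m / 4 ≤ #W ∧ η * Fintype.card V / 2 ≤ #X ∧
          e2 G W X < p * #W * #X / 2} = ∅ := by
        ext G
        simp only [Set.mem_ofPred_eq, Set.mem_empty_iff_false, iff_false]
        exact fun h => hWX ⟨h.1, h.2.1, h.2.2.1⟩
      rw [this, pr, Set.indicator_empty]
      exact (ex_const p 0).trans_le (by positivity)
  calc _ ≤ ∑ q : Finset V × Finset V, pr p {G : SimpleGraph V | Disjoint q.1 q.2 ∧
      m / 4 ≤ #q.1 ∧ η * Fintype.card V / 2 ≤ #q.2 ∧ e2 G q.1 q.2 < p * #q.1 * #q.2 / 2} := by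
        refine pr_biUnion_le h0 h1 univ _ fun G hG => ?_
        obtain ⟨W, X, h⟩ := hG
        exact ⟨(W, X), mem_univ _, h⟩
    _ ≤ ∑ q : Finset V × Finset V, Real.exp (-(3 * Fintype.card V)) := sum_le_sum fun q _ => hA q
    _ = 2 ^ Fintype.card V * 2 ^ Fintype.card V * Real.exp (-(3 * Fintype.card V)) := by simp
    _ ≤ Real.exp (Fintype.card V) * Real.exp (Fintype.card V) *
        Real.exp (-(3 * Fintype.card V)) := by
        gcongr <;> exact two_pow_le_exp _
    _ = _ := by rw [← Real.exp_add, ← Real.exp_add]; congr 1; ring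

lemma pr_union_le_add (h0 : 0 ≤ p) (h1 : p ≤ 1) {A B : Set (SimpleGraph V)} {a b : ℝ}
    (hA : pr p A ≤ a) (hB : pr p B ≤ b) : pr p (A ∪ B) ≤ a + b :=
  (pr_union_le h0 h1 Set.Subset.rfl).trans (add_le_add hA hB)

/-- The random graph is regular with high probability once `n p ^ 2 ≥ (5 / 4) log n`. -/
lemma pr_not_linkRegular_le (h0 : 0 ≤ p) (h1 : p ≤ 1) {ε η L m : ℝ} (hε : 0 < ε)
    (hε1 : ε ≤ 1 / 200) (hη : 0 < η) (hm : m = Fintype.card V * p) (hL : L = m * p)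
    (hn : 2 ≤ Fintype.card V) (hLn : 5 / 4 * Real.log (Fintype.card V) ≤ L)
    (hκL : 6 ≤ ε ^ 2 / 16 * Real.exp (-(6 / ε)) * L) (hηL : 3 ≤ η * L / 128) :
    pr p {G : SimpleGraph V | ¬ LinkRegular G p ε (Real.exp (-(6 / ε))) η} ≤
      2 * (Fintype.card V * Real.exp (1 - ε ^ 2 / 4 * m)) + 2 / Fintype.card V +
      2 * (Fintype.card V * Real.exp (-m)) +
      Fintype.card V * ((2 * m) ^ 2 * Real.exp (4 - 9 / 5 * L)) +
      Real.exp (-Fintype.card V) := by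
  have hm0 : 0 ≤ m := by rw [hm]; positivity
  have hL' : Fintype.card V * p ^ 2 = L := by rw [hL, hm]; ring
  have hdeg : ∀ F : V → Set (SimpleGraph V), (∀ v, pr p (F v) ≤ Real.exp (1 - ε ^ 2 / 4 * m)) →
      pr p {G | ∃ v, G ∈ F v} ≤ Fintype.card V * Real.exp (1 - ε ^ 2 / 4 * m) := fun F hF => by
    calc _ ≤ ∑ v, pr p (F v) := by
          refine pr_biUnion_le h0 h1 univ _ fun G hG => ?_
          obtain ⟨v, hv⟩ := hG
          exact ⟨v, mem_univ _, hv⟩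
      _ ≤ ∑ v : V, Real.exp (1 - ε ^ 2 / 4 * m) := sum_le_sum fun v _ => hF v
      _ = _ := by simp
  have hd1 := hdeg (fun v => {G | (#(nb G v) : ℝ) ≤ (1 - ε) * m}) fun v => by
    have := pr_deg_lt_le h0 h1 hε (by linarith) v
    rwa [← hm] at this
  have hd2 := hdeg (fun v => {G | (1 + ε) * m ≤ (#(nb G v) : ℝ)}) fun v => by
    have := pr_lt_deg_le h0 h1 hε (by linarith) v
    rwa [← hm] at this
  have hli := pr_light_le h0 h1 hε hL'.symm hLn hn
  have hin := pr_inner_le h0 h1 hε (by linarith) hm hL hκL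
  have hcr := pr_cross_le h0 h1 hε (by linarith) hm hL hκL
  have hco := pr_codeg_le h0 h1 hm hL
  have hex := pr_expand_le h0 h1 hη hm hL hηL
  have hall := pr_union_le_add h0 h1 hd1 <| pr_union_le_add h0 h1 hd2 <|
    pr_union_le_add h0 h1 hli <| pr_union_le_add h0 h1 hin <| pr_union_le_add h0 h1 hcr <|
    pr_union_le_add h0 h1 hco hex
  refine (pr_mono h0 h1 fun G hG => ?_).trans (hall.trans (le_of_eq (by ring)))
  by_contra hU
  simp only [Set.mem_union, Set.mem_ofPred_eq, not_or, not_exists, not_and, not_lt, not_le] at hU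
  obtain ⟨u1, u2, u3, u4, u5, u6, u7⟩ := hU
  have hd : ∀ v, (#(nb G v) : ℝ) ≤ 2 * m := fun v => by
    linarith [u2 v, mul_le_mul_of_nonneg_right hε1 hm0]
  have hd' : ∀ v, 199 / 200 * m ≤ (#(nb G v) : ℝ) := fun v => by
    linarith [u1 v, mul_le_mul_of_nonneg_right hε1 hm0]
  refine hG ⟨?_, ?_, ?_, ?_, ?_, ?_, ?_⟩
  · intro v; rw [← hm]; exact (u1 v).le
  · intro v; rw [← hm]; exact (u2 v).le
  · intro A hA; rw [hL']; exact u3 A hA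
  · intro v A hA hA'; rw [hL']; rw [← hm] at hA'; exact u4 v (hd v) A hA hA'
  · intro v A hA B hB hAB hA'; rw [hL']; rw [← hm] at hA'; exact u5 v (hd v) A hA B hB hAB hA'
  · intro v a b ha hb hab; rw [hL']
    exact u6 v ⟨hd' v, hd v⟩ a b (mem_nb.2 ha) (mem_nb.2 hb) hab
  · intro W X hWX hW hX
    rw [← hm] at hW
    exact u7 W X hWX hW hX

end Dense
-- Below the threshold: moments of the number of edges in no triangle.
section Sparse
open Finset
open scoped Classical

variable {V : Type*} [Fintype V] {p : ℝ}

lemma prod_le_prod_of_subset_of_le_one_real {ι : Type*} {s t : Finset ι} {f : ι → ℝ} (h : s ⊆ t)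
    (h0 : ∀ i, 0 ≤ f i) (h1 : ∀ i, f i ≤ 1) : ∏ i ∈ t, f i ≤ ∏ i ∈ s, f i := by
  rw [← prod_sdiff h]
  exact mul_le_of_le_one_left (prod_nonneg fun i _ => h0 i)
    (prod_le_one (fun i _ => h0 i) fun i _ => h1 i)

/-- Edges inside `K` and the edges from each outside vertex to `K` form disjoint families. Taking
`K` to be the endpoints of the edges under study factors the expectation over the possible third
vertices. -/
lemma ex_mul_prod_star (p : ℝ) (K : Finset V) {f : SimpleGraph V → ℝ} {g : V → SimpleGraph V → ℝ}
    (hf : DependsOn f {e | ∀ x ∈ e, x ∈ K})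
    (hg : ∀ w, DependsOn (g w) {e | ∃ x ∈ K, e = s(x, w)}) :
    ex p (fun G => f G * ∏ w ∈ Kᶜ, g w G) = ex p f * ∏ w ∈ Kᶜ, ex p (g w) := by
  rw [ex_mul p hf (DependsOn.prod fun w _ => hg w), ex_prod p Kᶜ fun w _ => hg w]
  · rintro w hw w' hw' hne e ⟨x, hx, rfl⟩ ⟨y, hy, hxy⟩
    rw [mem_compl] at hw hw'
    rcases Sym2.eq_iff.1 hxy with ⟨-, h⟩ | ⟨h, -⟩
    · exact absurd h hne
    · exact absurd (h ▸ hx) hw'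
  · intro e he he'
    obtain ⟨w, hw, x, hx, rfl⟩ := Set.mem_iUnion₂.1 he'
    exact absurd (he w (by simp)) (mem_compl.1 hw)

/-- The indicator that `ab` is an edge in no triangle. -/
noncomputable def lonely (G : SimpleGraph V) (a b : V) : ℝ :=
  adj G a b * ∏ w, (1 - adj G a w * adj G b w)

lemma one_sub_adj_mul_nonneg (G : SimpleGraph V) (a b c d : V) :
    0 ≤ 1 - adj G a b * adj G c d := by
  have := mul_le_one₀ (adj_le_one G a b) (adj_nonneg G c d) (adj_le_one G c d)
  linarith

lemma one_sub_adj_mul_le_one (G : SimpleGraph V) (a b c d : V) :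
    1 - adj G a b * adj G c d ≤ 1 := by
  have := mul_nonneg (adj_nonneg G a b) (adj_nonneg G c d)
  linarith

lemma lonely_nonneg (G : SimpleGraph V) (a b : V) : 0 ≤ lonely G a b :=
  mul_nonneg (adj_nonneg ..) (prod_nonneg fun _ _ => one_sub_adj_mul_nonneg ..)

lemma lonely_le_one (G : SimpleGraph V) (a b : V) : lonely G a b ≤ 1 :=
  mul_le_one₀ (adj_le_one ..) (prod_nonneg fun _ _ => one_sub_adj_mul_nonneg ..)
    (prod_le_one (fun _ _ => one_sub_adj_mul_nonneg ..) fun _ _ => one_sub_adj_mul_le_one ..)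

lemma lonely_comm (G : SimpleGraph V) (a b : V) : lonely G a b = lonely G b a := by
  simp only [lonely, adj_comm G a b, mul_comm]

lemma lonely_eq_zero {G : SimpleGraph V} (hQ : EveryEdgeInTriangle G) (a b : V) :
    lonely G a b = 0 := by
  by_cases hab : G.Adj a b
  · obtain ⟨w, haw, hbw⟩ := hQ a b hab
    rw [lonely, prod_eq_zero (mem_univ w) (by simp [adj, haw, hbw]), mul_zero]
  · simp [lonely, adj, hab]

lemma adj_congr {G G' : SimpleGraph V} {T : Set (Sym2 V)}
    (h : ∀ e ∈ T, ¬ e.IsDiag → (e ∈ G.edgeSet ↔ e ∈ G'.edgeSet)) {a b : V} (hab : s(a, b) ∈ T) :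
    adj G a b = adj G' a b :=
  dependsOn_adj a b G G' fun e he => h e (by rw [Set.mem_singleton_iff] at he; rwa [he])

lemma ex_adj_mul_adj (p : ℝ) {a b c d : V} (hab : a ≠ b) (hcd : c ≠ d) (h : s(a, b) ≠ s(c, d)) :
    ex p (fun G => adj G a b * adj G c d) = p * p := by
  rw [ex_mul p (dependsOn_adj a b) (dependsOn_adj c d), ex_adj p hab, ex_adj p hcd]
  intro e he he'
  rw [Set.mem_singleton_iff] at he he'
  exact absurd (he.symm.trans he') h

lemma ex_adj_mul_adj_mul_adj (p : ℝ) {a b c d x y : V} (hab : a ≠ b) (hcd : c ≠ d) (hxy : x ≠ y)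
    (h : s(a, b) ≠ s(c, d)) (h' : s(a, b) ≠ s(x, y)) (h'' : s(c, d) ≠ s(x, y)) :
    ex p (fun G => adj G a b * adj G c d * adj G x y) = p * p * p := by
  rw [ex_mul p ((dependsOn_adj a b).mul (dependsOn_adj c d)) (dependsOn_adj x y),
    ex_adj_mul_adj p hab hcd h, ex_adj p hxy]
  intro e he he'
  rw [Set.mem_singleton_iff] at he'
  rcases he with he | he <;> rw [Set.mem_singleton_iff] at he
  · exact absurd (he.symm.trans he') h'
  · exact absurd (he.symm.trans he') h''

lemma ex_one_sub_adj_mul_adj (p : ℝ) {a b w : V} (hab : a ≠ b) (ha : a ≠ w) (hb : b ≠ w) :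
    ex p (fun G => 1 - adj G a w * adj G b w) = 1 - p ^ 2 := by
  rw [ex_sub, ex_const, ex_adj_mul_adj p ha hb (by simp [hab, ha])]; ring

lemma ex_lonely (p : ℝ) {a b : V} (hab : a ≠ b) :
    ex p (fun G => lonely G a b) = p * (1 - p ^ 2) ^ (Fintype.card V - 2) := by
  have h1 : (fun G : SimpleGraph V => lonely G a b) =
      fun G => adj G a b * ∏ w ∈ ({a, b} : Finset V)ᶜ, (1 - adj G a w * adj G b w) := by
    ext G
    rw [lonely, ← prod_mul_prod_compl ({a, b} : Finset V), prod_pair hab]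
    simp [adj]
  rw [h1, ex_mul_prod_star p {a, b} (f := fun G => adj G a b)
    (g := fun w G => 1 - adj G a w * adj G b w), ex_adj p hab]
  · rw [prod_congr rfl fun w hw => ex_one_sub_adj_mul_adj p hab
      (by rintro rfl; simp at hw) (by rintro rfl; simp at hw)]
    rw [prod_const, card_compl, card_pair hab]
  · intro G G' h
    exact adj_congr h (by simp)
  · intro w G G' h
    simp only
    rw [adj_congr h (a := a) (b := w) ⟨a, by simp, rfl⟩,
      adj_congr h (a := b) (b := w) ⟨b, by simp, rfl⟩]

/-- Two edges at `a` share the variable `aw`, so a third vertex `w` avoids both triangles with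
probability `1 - 2p² + p³`. Conditions at `w` in `{a, b, c}` are discarded, which only raises the
value. -/
lemma ex_lonely_mul_lonely_of_common (h0 : 0 ≤ p) (h1 : p ≤ 1) {a b c : V} (hab : a ≠ b)
    (hac : a ≠ c) (hbc : b ≠ c) :
    ex p (fun G => lonely G a b * lonely G a c) ≤
      p ^ 2 * (1 - 2 * p ^ 2 + p ^ 3) ^ (Fintype.card V - 3) := by
  have hcard : #({a, b, c} : Finset V) = 3 := card_eq_three.2 ⟨a, b, c, hab, hac, hbc, rfl⟩
  calc _ ≤ ex p (fun G => (adj G a b * adj G a c) * ∏ w ∈ ({a, b, c} : Finset V)ᶜ,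
        ((1 - adj G a w * adj G b w) * (1 - adj G a w * adj G c w))) := by
        refine ex_mono h0 h1 fun G => ?_
        have e1 : lonely G a b * lonely G a c = (adj G a b * adj G a c) *
            ∏ w, ((1 - adj G a w * adj G b w) * (1 - adj G a w * adj G c w)) := by
          simp only [lonely, prod_mul_distrib]; ring
        rw [e1]
        refine mul_le_mul_of_nonneg_left ?_ (mul_nonneg (adj_nonneg ..) (adj_nonneg ..))
        exact prod_le_prod_of_subset_of_le_one_real (subset_univ _)
          (fun w => mul_nonneg (one_sub_adj_mul_nonneg ..) (one_sub_adj_mul_nonneg ..))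
          fun w => mul_le_one₀ (one_sub_adj_mul_le_one ..) (one_sub_adj_mul_nonneg ..)
            (one_sub_adj_mul_le_one ..)
    _ = p * p * ∏ w ∈ ({a, b, c} : Finset V)ᶜ, (1 - 2 * p ^ 2 + p ^ 3) := by
        rw [ex_mul_prod_star p {a, b, c} (f := fun G => adj G a b * adj G a c)
          (g := fun w G => (1 - adj G a w * adj G b w) * (1 - adj G a w * adj G c w))]
        · rw [ex_adj_mul_adj p hab hac (by simp [hbc, hac])]
          congr 1
          refine prod_congr rfl fun w hw => ?_
          have ha : a ≠ w := by rintro rfl; simp at hw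
          have hb : b ≠ w := by rintro rfl; simp at hw
          have hc : c ≠ w := by rintro rfl; simp at hw
          have e1 : ∀ G : SimpleGraph V,
              (1 - adj G a w * adj G b w) * (1 - adj G a w * adj G c w) =
              (1 - adj G a w * adj G b w) + (adj G a w * adj G b w * adj G c w
                - adj G a w * adj G c w) := by
            intro G
            have : adj G a w * adj G a w = adj G a w := by unfold adj; split_ifs <;> simp
            linear_combination (adj G b w * adj G c w) * this
          simp only [e1]
          rw [ex_add, ex_one_sub_adj_mul_adj p hab ha hb, ex_sub,
            ex_adj_mul_adj p ha hc (by simp [hac, ha]),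
            ex_adj_mul_adj_mul_adj p ha hb hc (by simp [hab, ha]) (by simp [hac, ha])
              (by simp [hbc, hb])]
          ring
        · intro G G' h
          simp only
          rw [adj_congr h (a := a) (b := b) (by simp), adj_congr h (a := a) (b := c) (by simp)]
        · intro w G G' h
          simp only
          rw [adj_congr h (a := a) (b := w) ⟨a, by simp, rfl⟩,
            adj_congr h (a := b) (b := w) ⟨b, by simp, rfl⟩,
            adj_congr h (a := c) (b := w) ⟨c, by simp, rfl⟩]
    _ = _ := by rw [prod_const, card_compl, hcard]; ring

/-- For `w` outside the four endpoints the two triangle conditions use different edges, hence are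
independent; the conditions at the endpoints are discarded. -/
lemma ex_lonely_mul_lonely_of_disjoint (h0 : 0 ≤ p) (h1 : p ≤ 1) {a b c d : V} (hab : a ≠ b)
    (hac : a ≠ c) (had : a ≠ d) (hbc : b ≠ c) (hbd : b ≠ d) (hcd : c ≠ d) :
    ex p (fun G => lonely G a b * lonely G c d) ≤
      p ^ 2 * ((1 - p ^ 2) ^ 2) ^ (Fintype.card V - 4) := by
  have hcard : #({a, b, c, d} : Finset V) = 4 := by
    rw [card_insert_of_notMem (by simp [hab, hac, had]),
      card_insert_of_notMem (by simp [hbc, hbd]), card_pair hcd]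
  calc _ ≤ ex p (fun G => (adj G a b * adj G c d) * ∏ w ∈ ({a, b, c, d} : Finset V)ᶜ,
        ((1 - adj G a w * adj G b w) * (1 - adj G c w * adj G d w))) := by
        refine ex_mono h0 h1 fun G => ?_
        have e1 : lonely G a b * lonely G c d = (adj G a b * adj G c d) *
            ∏ w, ((1 - adj G a w * adj G b w) * (1 - adj G c w * adj G d w)) := by
          simp only [lonely, prod_mul_distrib]; ring
        rw [e1]
        refine mul_le_mul_of_nonneg_left ?_ (mul_nonneg (adj_nonneg ..) (adj_nonneg ..))
        exact prod_le_prod_of_subset_of_le_one_real (subset_univ _)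
          (fun w => mul_nonneg (one_sub_adj_mul_nonneg ..) (one_sub_adj_mul_nonneg ..))
          fun w => mul_le_one₀ (one_sub_adj_mul_le_one ..) (one_sub_adj_mul_nonneg ..)
            (one_sub_adj_mul_le_one ..)
    _ = p * p * ∏ w ∈ ({a, b, c, d} : Finset V)ᶜ, (1 - p ^ 2) ^ 2 := by
        rw [ex_mul_prod_star p {a, b, c, d} (f := fun G => adj G a b * adj G c d)
          (g := fun w G => (1 - adj G a w * adj G b w) * (1 - adj G c w * adj G d w))]
        · rw [ex_adj_mul_adj p hab hcd (by simp [hac, had])]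
          congr 1
          refine prod_congr rfl fun w hw => ?_
          have ha : a ≠ w := by rintro rfl; simp at hw
          have hb : b ≠ w := by rintro rfl; simp at hw
          have hc : c ≠ w := by rintro rfl; simp at hw
          have hd : d ≠ w := by rintro rfl; simp at hw
          rw [ex_mul p (T := {e | ∃ x ∈ ({a, b} : Finset V), e = s(x, w)})
            (T' := {e | ∃ x ∈ ({c, d} : Finset V), e = s(x, w)}),
            ex_one_sub_adj_mul_adj p hab ha hb, ex_one_sub_adj_mul_adj p hcd hc hd, ← sq]
          · intro G G' h
            simp only
            rw [adj_congr h (a := a) (b := w) ⟨a, by simp, rfl⟩,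
              adj_congr h (a := b) (b := w) ⟨b, by simp, rfl⟩]
          · intro G G' h
            simp only
            rw [adj_congr h (a := c) (b := w) ⟨c, by simp, rfl⟩,
              adj_congr h (a := d) (b := w) ⟨d, by simp, rfl⟩]
          · rintro e ⟨x, hx, rfl⟩ ⟨y, hy, hxy⟩
            simp only [mem_insert, mem_singleton] at hx hy
            rcases hx with rfl | rfl <;> rcases hy with rfl | rfl <;>
              simp_all
        · intro G G' h
          simp only
          rw [adj_congr h (a := a) (b := b) (by simp), adj_congr h (a := c) (b := d) (by simp)]
        · intro w G G' h
          simp only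
          rw [adj_congr h (a := a) (b := w) ⟨a, by simp, rfl⟩,
            adj_congr h (a := b) (b := w) ⟨b, by simp, rfl⟩,
            adj_congr h (a := c) (b := w) ⟨c, by simp, rfl⟩,
            adj_congr h (a := d) (b := w) ⟨d, by simp, rfl⟩]
    _ = _ := by rw [prod_const, card_compl, hcard]; ring

/-- Bounds for the correlations of `lonely`, depending on how two pairs intersect. -/
lemma ex_lonely_mul_lonely_le (h0 : 0 ≤ p) (h1 : p ≤ 1) {q r s : ℝ}
    (hq : q = p * (1 - p ^ 2) ^ (Fintype.card V - 2))
    (hr : r = p ^ 2 * (1 - 2 * p ^ 2 + p ^ 3) ^ (Fintype.card V - 3))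
    (hs : s = p ^ 2 * ((1 - p ^ 2) ^ 2) ^ (Fintype.card V - 4)) {a b c d : V} (hab : a ≠ b)
    (hcd : c ≠ d) :
    ex p (fun G => lonely G a b * lonely G c d) ≤ s +
      r * ((if c = a then 1 else 0) + (if c = b then 1 else 0) + (if d = a then 1 else 0) +
        (if d = b then 1 else 0)) +
      q * ((if (c, d) = (a, b) then 1 else 0) + if (c, d) = (b, a) then 1 else 0) := by
  have hp2 : p ^ 2 ≤ 1 := pow_le_one₀ h0 h1
  have hq0 : 0 ≤ q := by
    rw [hq]; exact mul_nonneg h0 (pow_nonneg (by linarith) _)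
  have hr0 : 0 ≤ r := by
    rw [hr]
    refine mul_nonneg (by positivity) (pow_nonneg ?_ _)
    have : 0 ≤ (1 - p) * (1 + p - p ^ 2) := mul_nonneg (by linarith) (by linarith)
    nlinarith
  have hs0 : 0 ≤ s := by rw [hs]; positivity
  have hsame : ∀ {x y : V}, x ≠ y → ex p (fun G => lonely G x y * lonely G x y) ≤ q :=
    fun {x y} hxy => by
      rw [hq, ← ex_lonely p hxy]
      exact ex_mono h0 h1 fun G => mul_le_of_le_one_left (lonely_nonneg ..) (lonely_le_one ..)
  by_cases hca : c = a
  · subst hca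
    by_cases hdb : d = b
    · subst hdb
      have := hsame hab
      simp only [if_true, hcd, hcd.symm, if_false, Prod.mk.injEq, and_self]
      linarith
    · have := ex_lonely_mul_lonely_of_common h0 h1 hab hcd (Ne.symm hdb)
      rw [← hr] at this
      simp only [if_true, hcd.symm, hab, hdb, if_false, Prod.mk.injEq, and_false]
      linarith
  · by_cases hcb : c = b
    · subst hcb
      by_cases hda : d = a
      · subst hda
        have := hsame hab
        simp only [lonely_comm _ c d]
        simp only [if_true, hcd, hcd.symm, if_false, Prod.mk.injEq, and_self]
        linarith
      · have := ex_lonely_mul_lonely_of_common h0 h1 hab.symm hcd (Ne.symm hda)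
        rw [← hr] at this
        simp only [lonely_comm _ a c]
        simp only [if_true, hcd.symm, hca, hda, if_false, Prod.mk.injEq, and_false]
        linarith
    · by_cases hda : d = a
      · subst hda
        have := ex_lonely_mul_lonely_of_common h0 h1 hab hcd.symm (Ne.symm hcb)
        rw [← hr] at this
        simp only [lonely_comm _ c d]
        simp only [if_true, hca, hcb, hab, if_false, Prod.mk.injEq, false_and]
        linarith
      · by_cases hdb : d = b
        · subst hdb
          have := ex_lonely_mul_lonely_of_common h0 h1 hab.symm hcd.symm (Ne.symm hca)
          rw [← hr] at this
          simp only [lonely_comm _ c d, lonely_comm _ a d]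
          simp only [if_true, hca, hcb, hda, if_false, Prod.mk.injEq, false_and]
          linarith
        · have := ex_lonely_mul_lonely_of_disjoint h0 h1 hab (Ne.symm hca) (Ne.symm hda)
            (Ne.symm hcb) (Ne.symm hdb) hcd
          rw [← hs] at this
          simp only [hca, hcb, hda, hdb, if_false, Prod.mk.injEq, false_and]
          linarith

/-- Chebyshev's inequality for the number of edges in no triangle. -/
lemma pr_everyEdgeInTriangle_le (h0 : 0 < p) (h1 : p < 1) {N q r s : ℝ}
    (hn : 2 ≤ Fintype.card V) (hN : N = Fintype.card V * (Fintype.card V - 1))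
    (hq : q = p * (1 - p ^ 2) ^ (Fintype.card V - 2))
    (hr : r = p ^ 2 * (1 - 2 * p ^ 2 + p ^ 3) ^ (Fintype.card V - 3))
    (hs : s = p ^ 2 * ((1 - p ^ 2) ^ 2) ^ (Fintype.card V - 4)) :
    pr p {G : SimpleGraph V | EveryEdgeInTriangle G} ≤
      s / q ^ 2 - 1 + 4 * Fintype.card V * r / (N * q ^ 2) + 2 / (N * q) := by
  set I : Finset (V × V) := univ.offDiag with hI
  have hIne : ∀ {x : V × V}, x ∈ I → x.1 ≠ x.2 := fun {x} hx => by simpa [hI] using hx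
  have hn2 : (2 : ℝ) ≤ Fintype.card V := by exact_mod_cast hn
  have hIcard : (#I : ℝ) = N := by
    rw [hI, offDiag_card, card_univ, Nat.cast_sub (Nat.le_mul_self _), hN]; push_cast; ring
  have hN0 : 0 < N := by rw [hN]; exact mul_pos (by linarith) (by linarith)
  have hq0 : 0 < q := by
    rw [hq]
    have : p ^ 2 < 1 := pow_lt_one₀ h0.le h1 two_ne_zero
    exact mul_pos h0 (pow_pos (by linarith) _)
  set X : SimpleGraph V → ℝ := fun G => ∑ x ∈ I, lonely G x.1 x.2 with hX
  have hEX : ex p X = N * q := by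
    rw [hX, ex_sum, sum_congr rfl fun x hx => ex_lonely p (hIne hx), sum_const, nsmul_eq_mul,
      hIcard, hq]
  -- There are at most `4n` coincidences of one coordinate with an endpoint, and two orderings of
  -- the same pair.
  have hrow : ∀ x ∈ I, ∑ y ∈ I, ex p (fun G => lonely G x.1 x.2 * lonely G y.1 y.2) ≤
      N * s + r * (4 * Fintype.card V) + q * 2 := by
    rintro ⟨a, b⟩ hx
    refine (sum_le_sum fun y hy =>
      ex_lonely_mul_lonely_le h0.le h1.le hq hr hs (hIne hx) (hIne hy)).trans ?_
    rw [sum_add_distrib, sum_add_distrib, ← mul_sum, ← mul_sum, sum_const, nsmul_eq_mul, hIcard]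
    have hr0 : 0 ≤ r := by
      rw [hr]
      refine mul_nonneg (by positivity) (pow_nonneg ?_ _)
      have hp2 : p ^ 2 ≤ 1 := pow_le_one₀ h0.le h1.le
      have : 0 ≤ (1 - p) * (1 + p - p ^ 2) := mul_nonneg (by linarith) (by linarith)
      nlinarith
    have e1 : ∀ f : V × V → ℝ, (∀ y, 0 ≤ f y) → ∑ y ∈ I, f y ≤ ∑ c, ∑ d, f (c, d) := fun f hf => by
      rw [← sum_product', univ_product_univ]
      exact sum_le_sum_of_subset_of_nonneg (subset_univ _) fun y _ _ => hf y
    refine add_le_add (add_le_add le_rfl (mul_le_mul_of_nonneg_left ?_ hr0))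
      (mul_le_mul_of_nonneg_left ?_ hq0.le)
    · refine (e1 _ fun y => by positivity).trans (le_of_eq ?_)
      change ∑ c : V, ∑ d : V, ((((if c = a then (1 : ℝ) else 0) + (if c = b then 1 else 0)) +
        (if d = a then 1 else 0)) + (if d = b then 1 else 0)) = _
      simp only [sum_add_distrib, sum_const, ← mul_sum, sum_ite_eq', mem_univ, if_true,
        nsmul_eq_mul, mul_one, card_univ]
      ring
    · refine (e1 _ fun y => by positivity).trans (le_of_eq ?_)
      simp only [sum_add_distrib, Prod.mk.injEq, ite_and]
      simp
      norm_num
  have hEX2 : ex p (fun G => X G ^ 2) ≤ N * (N * s + r * (4 * Fintype.card V) + q * 2) := by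
    have e1 : ∀ G, X G ^ 2 = ∑ x ∈ I, ∑ y ∈ I, lonely G x.1 x.2 * lonely G y.1 y.2 := fun G => by
      rw [sq, hX, sum_mul_sum]
    simp only [e1]
    rw [ex_sum]
    simp only [ex_sum]
    refine (sum_le_sum hrow).trans (le_of_eq ?_)
    rw [sum_const, nsmul_eq_mul, hIcard]
  have hvar : ex p (fun G => (X G - N * q) ^ 2) = ex p (fun G => X G ^ 2) - (N * q) ^ 2 := by
    have e1 : ∀ G, (X G - N * q) ^ 2 = X G ^ 2 - 2 * (N * q) * X G + (N * q) ^ 2 := fun G => by ring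
    simp only [e1]
    rw [ex_add, ex_sub, ex_const_mul, ex_const, hEX]; ring
  -- Under `Q` the count `X` vanishes, so it deviates from its mean by the full `Nq`.
  have hch : pr p {G : SimpleGraph V | EveryEdgeInTriangle G} ≤
      ex p fun G => 1 / (N * q) ^ 2 * (X G - N * q) ^ 2 := by
    refine pr_le_ex h0.le h1.le (fun G => by positivity) fun G hG => ?_
    have : X G = 0 := sum_eq_zero fun x _ => lonely_eq_zero hG _ _
    have hNq : N * q ≠ 0 := by positivity
    rw [this, zero_sub, neg_sq, one_div, inv_mul_cancel₀ (pow_ne_zero 2 hNq)]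
  refine hch.trans ?_
  rw [ex_const_mul, hvar]
  calc _ ≤ 1 / (N * q) ^ 2 * (N * (N * s + r * (4 * Fintype.card V) + q * 2) - (N * q) ^ 2) := by
        gcongr
    _ = _ := by field_simp; ring

/-- A nonempty graph with `Q` contains a triangle; this is the first moment bound, for `p` too small
to expect many edges. -/
lemma pr_everyEdgeInTriangle_ne_bot_le (h0 : 0 ≤ p) (h1 : p ≤ 1) :
    pr p {G : SimpleGraph V | EveryEdgeInTriangle G ∧ G ≠ ⊥} ≤ (Fintype.card V * p) ^ 3 := by
  have hpt : ∀ x : V × V × V,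
      pr p {G : SimpleGraph V | G.Adj x.1 x.2.1 ∧ G.Adj x.1 x.2.2 ∧ G.Adj x.2.1 x.2.2} ≤
        p * p * p := by
    rintro ⟨a, b, c⟩
    simp only
    by_cases h : a ≠ b ∧ a ≠ c ∧ b ≠ c
    · obtain ⟨hab, hac, hbc⟩ := h
      rw [← ex_adj_mul_adj_mul_adj p hab hac hbc (by simp [hbc, hac]) (by simp [hac, hab])
        (by simp [hab, hac])]
      refine pr_le_ex h0 h1 (fun G => mul_nonneg (mul_nonneg (adj_nonneg ..) (adj_nonneg ..))
        (adj_nonneg ..)) fun G hG => ?_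
      obtain ⟨g1, g2, g3⟩ := hG
      simp [adj, g1, g2, g3]
    · have : {G : SimpleGraph V | G.Adj a b ∧ G.Adj a c ∧ G.Adj b c} = ∅ := by
        ext G
        simp only [Set.mem_ofPred_eq, Set.mem_empty_iff_false, iff_false]
        exact fun hG => h ⟨hG.1.ne, hG.2.1.ne, hG.2.2.ne⟩
      rw [this, pr, Set.indicator_empty]
      exact (ex_const p 0).trans_le (by positivity)
  calc _ ≤ ∑ x : V × V × V,
        pr p {G : SimpleGraph V | G.Adj x.1 x.2.1 ∧ G.Adj x.1 x.2.2 ∧ G.Adj x.2.1 x.2.2} := by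
        refine pr_biUnion_le h0 h1 univ _ fun G hG => ?_
        obtain ⟨hQ, hG⟩ := hG
        obtain ⟨a, b, hab⟩ := SimpleGraph.ne_bot_iff_exists_adj.1 hG
        obtain ⟨w, haw, hbw⟩ := hQ a b hab
        exact ⟨(a, b, w), mem_univ _, hab, haw, hbw⟩
    _ ≤ ∑ x : V × V × V, p * p * p := sum_le_sum fun x _ => hpt x
    _ = _ := by simp; ring

end Sparse
-- From vectors of the edge space to subgraphs, and reduction to a minimal element.
section EdgeSpace
open Finset
open scoped Classical

variable {V : Type*} [Fintype V] {G : SimpleGraph V}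

lemma mem_perp_span {s : Set (G.edgeSet → ZMod 2)} {F : G.edgeSet → ZMod 2} :
    F ∈ perp (Submodule.span (ZMod 2) s) ↔ ∀ x ∈ s, ∑ e, x e * F e = 0 := by
  simp only [perp, Submodule.mem_orthogonalBilin_iff]
  refine ⟨fun h x hx => h x (Submodule.subset_span hx), fun h x hx => ?_⟩
  induction hx using Submodule.span_induction with
  | mem x hx => exact h x hx
  | zero => simp
  | add x y _ _ hx hy => rw [map_add, LinearMap.add_apply, hx, hy, add_zero]
  | smul c x _ hx => rw [map_smul, LinearMap.smul_apply, hx, smul_zero]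

/-- The subgraph of `G` whose indicator is `F`. -/
def support (F : G.edgeSet → ZMod 2) : SimpleGraph V where
  Adj u v := ∃ h : G.Adj u v, F ⟨s(u, v), h⟩ ≠ 0
  symm := ⟨fun u v ⟨h, hF⟩ => ⟨h.symm, by
    have : (⟨s(v, u), h.symm⟩ : G.edgeSet) = ⟨s(u, v), h⟩ := Subtype.ext Sym2.eq_swap
    rwa [this]⟩⟩
  loopless := ⟨fun u ⟨h, _⟩ => G.loopless.irrefl u h⟩

lemma support_le (F : G.edgeSet → ZMod 2) : support F ≤ G := fun _ _ h => h.1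

lemma support_adj_iff (F : G.edgeSet → ZMod 2) {u v : V} (h : G.Adj u v) :
    (support F).Adj u v ↔ F ⟨s(u, v), h⟩ ≠ 0 :=
  ⟨fun h' => h'.2, fun h' => ⟨h, h'⟩⟩

lemma sum_triangle_mul {u v w : V} (huv : G.Adj u v) (hvw : G.Adj v w) (huw : G.Adj u w)
    (F : G.edgeSet → ZMod 2) :
    ∑ e, edgeIndicator G {s(u, v), s(v, w), s(u, w)} e * F e =
      F ⟨s(u, v), huv⟩ + F ⟨s(v, w), hvw⟩ + F ⟨s(u, w), huw⟩ := by
  have h1 : ∑ e, edgeIndicator G {s(u, v), s(v, w), s(u, w)} e * F e =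
      ∑ e ∈ ({⟨s(u, v), huv⟩, ⟨s(v, w), hvw⟩, ⟨s(u, w), huw⟩} : Finset G.edgeSet), F e := by
    simp only [edgeIndicator, ite_mul, one_mul, zero_mul]
    rw [← sum_filter]
    congr 1
    ext ⟨e, he⟩
    simp [Subtype.ext_iff]
  have h2 := huv.ne
  have h3 := hvw.ne
  have h4 := huw.ne
  rw [h1, sum_insert, sum_pair, add_assoc]
  · simp [Subtype.ext_iff, h2.symm, h3]
  · simp [Subtype.ext_iff, h2, h3, h4, h2.symm]

lemma evenOnTriangles_support {F : G.edgeSet → ZMod 2} (hF : F ∈ perp (triangleSpace G)) :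
    EvenOnTriangles G (support F) := by
  intro u v w huv hvw huw
  have h := mem_perp_span.1 hF _ ⟨u, v, w, huv, hvw, huw, rfl⟩
  rw [sum_triangle_mul huv hvw huw] at h
  rw [support_adj_iff F huv, support_adj_iff F hvw, support_adj_iff F huw]
  generalize F ⟨s(u, v), huv⟩ = x at *
  generalize F ⟨s(v, w), hvw⟩ = y at *
  generalize F ⟨s(u, w), huw⟩ = z at *
  revert x y z
  decide

/-- The indicator of the set of edges at `v`. -/
noncomputable def star (G : SimpleGraph V) (v : V) : G.edgeSet → ZMod 2 :=
  edgeIndicator G {e | v ∈ e}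

/-- A closed trail uses an even number of edges at each vertex. -/
lemma star_mem_perp_cycleSpace (v : V) : star G v ∈ perp (cycleSpace G) := by
  refine mem_perp_span.2 ?_
  rintro _ ⟨u, c, hc, rfl⟩
  have heven : Even (c.edges.countP fun e => decide (v ∈ e)) := by
    rw [hc.isTrail.even_countP_edges_iff]; simp
  have h1 : ∑ e, edgeIndicator G {e | e ∈ c.edges} e * star G v e =
      (#(univ.filter fun e : G.edgeSet => (e : Sym2 V) ∈ c.edges ∧ v ∈ (e : Sym2 V)) : ZMod 2) := by
    rw [← sum_boole]
    refine sum_congr rfl fun e _ => ?_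
    simp only [edgeIndicator, star, Set.mem_ofPred_eq, ite_and, ite_mul, one_mul, zero_mul]
    congr
  have h2 : #(univ.filter fun e : G.edgeSet => (e : Sym2 V) ∈ c.edges ∧ v ∈ (e : Sym2 V)) =
      c.edges.countP fun e => decide (v ∈ e) := by
    rw [List.countP_eq_length_filter,
      ← List.toFinset_card_of_nodup (hc.isTrail.edges_nodup.filter _)]
    refine card_bij (fun e _ => (e : Sym2 V)) ?_ ?_ ?_
    · intro e he
      simpa using he
    · intro e _ e' _ h
      exact Subtype.ext h
    · intro e he
      have he' : e ∈ c.edges ∧ v ∈ e := by simpa using he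
      exact ⟨⟨e, c.edges_subset_edgeSet he'.1⟩, by simpa using he', rfl⟩
  rw [h1, h2]
  exact ZMod.natCast_eq_zero_iff_even.2 heven

lemma star_mem_perp_triangleSpace (v : V) : star G v ∈ perp (triangleSpace G) := by
  refine mem_perp_span.2 ?_
  rintro _ ⟨a, b, c, hab, hbc, hac, rfl⟩
  rw [sum_triangle_mul hab hbc hac]
  have h1 := hab.ne
  have h2 := hbc.ne
  have h3 := hac.ne
  have h4 : (1 + 1 : ZMod 2) = 0 := by decide
  by_cases ha : v = a
  · subst ha; simp [star, edgeIndicator, h1, h3, h4]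
  · by_cases hb : v = b
    · subst hb; simp [star, edgeIndicator, h1.symm, h2, h4]
    · by_cases hc : v = c
      · subst hc; simp [star, edgeIndicator, h3.symm, h2.symm, h4]
      · simp [star, edgeIndicator, ha, hb, hc]

lemma size_eq_sum (F : G.edgeSet → ZMod 2) : size F = ∑ e, if F e ≠ 0 then 1 else 0 := by
  rw [sum_boole, Nat.cast_id, size, ← Set.ncard_coe_finset]
  congr 1
  ext e; simp

lemma card_nb_support (F : G.edgeSet → ZMod 2) (v : V) :
    #(nb (support F) v) = ∑ e : G.edgeSet, if v ∈ (e : Sym2 V) ∧ F e ≠ 0 then 1 else 0 := by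
  rw [sum_boole, Nat.cast_id]
  refine card_bij (fun w hw => ⟨s(v, w), (mem_nb.1 hw).1⟩) ?_ ?_ ?_
  · intro w hw
    simpa using (mem_nb.1 hw).2
  · intro w hw w' hw' h
    exact Sym2.congr_right.1 (congrArg Subtype.val h)
  · rintro ⟨e, he⟩ h
    simp only [mem_filter, mem_univ, true_and] at h
    obtain ⟨w, rfl⟩ := Sym2.mem_iff_exists.1 h.1
    exact ⟨w, mem_nb.2 ⟨he, h.2⟩, rfl⟩

lemma card_nb_eq_sum_edges (v : V) :
    #(nb G v) = ∑ e : G.edgeSet, if v ∈ (e : Sym2 V) then 1 else 0 := by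
  have h : support (fun _ : G.edgeSet => (1 : ZMod 2)) = G := by
    ext u v; simp [support]
  have h2 := card_nb_support (fun _ : G.edgeSet => (1 : ZMod 2)) v
  rw [h] at h2
  simpa using h2

lemma sum_card_nb_support (F : G.edgeSet → ZMod 2) :
    ∑ v, #(nb (support F) v) = 2 * size F := by
  simp only [card_nb_support, size_eq_sum]
  rw [sum_comm, mul_sum]
  refine sum_congr rfl fun e _ => ?_
  obtain ⟨e, he⟩ := e
  induction e with
  | _ a b =>
    have hab : a ≠ b := G.ne_of_adj he
    by_cases hF : F ⟨s(a, b), he⟩ = 0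
    · simp [hF]
    · simp only [hF, ne_eq, not_false_eq_true, and_true, Sym2.mem_iff, if_true, sum_boole]
      have : (univ.filter fun v => v = a ∨ v = b) = {a, b} := by ext; simp
      rw [this, card_pair hab]; rfl

/-- Adding a star complements the subgraph at `v`; at a minimal element this yields the half-degree
condition. -/
lemma size_add_star (F : G.edgeSet → ZMod 2) (v : V) :
    size (F + star G v) + 2 * #(nb (support F) v) = size F + #(nb G v) := by
  rw [card_nb_support, card_nb_eq_sum_edges, size_eq_sum, size_eq_sum, mul_sum,
    ← sum_add_distrib, ← sum_add_distrib]
  refine sum_congr rfl fun e _ => ?_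
  simp only [Pi.add_apply, star, edgeIndicator, Set.mem_ofPred_eq]
  by_cases hv : v ∈ (e : Sym2 V)
  · simp only [hv, if_true, true_and]
    generalize F e = x
    revert x
    decide
  · simp [hv]

/-- In a regular graph with property `Q`, elements of `𝒯^⊥ \ 𝒞^⊥` have at least about half of the
edges. -/
theorem LinkRegular.le_size_of_mem_perp {p κ η : ℝ} (hη : 0 < η) (hη1 : η < 1)
    (hκ : 0 < κ) (hκ1 : κ ≤ 1 / 8) (hp : 0 < p) (hn : 0 < Fintype.card V)
    (hbig : 2 ≤ η ^ 2 / 100000 * (κ * (Fintype.card V * p)))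
    (hG : LinkRegular G p (η ^ 2 / 100000) κ η) (hQ : EveryEdgeInTriangle G)
    {F : G.edgeSet → ZMod 2} (hT : F ∈ perp (triangleSpace G)) (hC : F ∉ perp (cycleSpace G)) :
    (1 - η) * (Fintype.card V : ℝ) ^ 2 * p / 4 ≤ size F := by
  -- Minimality is taken over the whole of `𝒯^⊥ \ 𝒞^⊥`, which is invariant under adding stars; lying
  -- outside `𝒞^⊥` also makes `F'` nonzero.
  obtain ⟨F', ⟨hT', hC'⟩, hmin⟩ := (measure (size (G := G))).wf.has_min
    {F | F ∈ perp (triangleSpace G) ∧ F ∉ perp (cycleSpace G)} ⟨F, hT, hC⟩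
  have hmin' : ∀ F'' ∈ {F | F ∈ perp (triangleSpace G) ∧ F ∉ perp (cycleSpace G)},
      size F' ≤ size F'' := fun F'' h => not_lt.1 (hmin F'' h)
  have hF0 : F' ≠ 0 := by rintro rfl; exact hC' (Submodule.zero_mem _)
  have hsize : 0 < size F' := by
    obtain ⟨e, he⟩ := Function.ne_iff.1 hF0
    rw [size_eq_sum]
    exact sum_pos' (fun _ _ => Nat.zero_le _) ⟨e, mem_univ _, by simpa [Nat.pos_iff_ne_zero] using he⟩
  have hhalf : ∀ v, 2 * #(nb (support F') v) ≤ #(nb G v) := fun v => by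
    have h1 := size_add_star F' v
    have h2 := hmin' (F' + star G v) ⟨Submodule.add_mem _ hT' (star_mem_perp_triangleSpace v),
      fun h => hC' <| by
        simpa using Submodule.sub_mem _ h (star_mem_perp_cycleSpace v)⟩
    omega
  have hsum : ∑ v, (#(nb (support F') v) : ℝ) = 2 * size F' := by
    exact_mod_cast sum_card_nb_support F'
  have hmain := hG.le_size hη hη1 hκ hκ1 hp hn hbig (support_le F')
    (evenOnTriangles_support hT') hQ (fun v => by exact_mod_cast hhalf v)
    (by rw [hsum]; exact_mod_cast Nat.mul_pos two_pos hsize)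
  have hle : (size F' : ℝ) ≤ size F := by exact_mod_cast hmin' F ⟨hT, hC⟩
  rw [hsum] at hmain
  linarith

lemma mem_perp_of_eq_bot (h : G = ⊥) (F : G.edgeSet → ZMod 2)
    (S : Submodule (ZMod 2) (G.edgeSet → ZMod 2)) : F ∈ perp S := by
  have : F = 0 := by
    subst h
    ext ⟨e, he⟩
    simp at he
  rw [this]
  exact Submodule.zero_mem _

end EdgeSpace
-- Uniform estimates of the error terms and their limits.
section Asymptotics
open Finset Filter Topology
open scoped Classical

variable {V : Type*} [Fintype V] {p : ℝ}

lemma inv_one_sub_pow_four_le {x : ℝ} (hx0 : 0 ≤ x) (hx : x ≤ 1 / 8) :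
    1 / (1 - x) ^ 4 - 1 ≤ 8 * x := by
  have h1 : 0 < (1 - x) ^ 4 := pow_pos (by linarith) 4
  rw [sub_le_iff_le_add, div_le_iff₀ h1]
  have h2 : 1 - 4 * x ≤ (1 - x) ^ 4 := by
    have := one_add_mul_le_pow (a := -x) (by linarith) 4
    push_cast at this
    rw [← sub_eq_add_neg] at this
    linarith
  have h3 : (8 * x + 1) * (1 - 4 * x) ≤ (8 * x + 1) * (1 - x) ^ 4 := by gcongr
  nlinarith

lemma exp_neg_le_one_sub_pow {x : ℝ} (hx0 : 0 ≤ x) (hx : x ≤ 1 / 8) (k : ℕ) :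
    Real.exp (-(k * x) - 2 * (k * x ^ 2)) ≤ (1 - x) ^ k := by
  have h1 : Real.exp (-x - 2 * x ^ 2) ≤ 1 - x := by
    have h2 : 1 - x ≤ 1 := by linarith
    have h3 : (1 - x)⁻¹ ≤ Real.exp (x + 2 * x ^ 2) := by
      refine le_trans ?_ (Real.add_one_le_exp _)
      rw [inv_le_iff_one_le_mul₀ (by linarith)]
      nlinarith [mul_nonneg hx0 hx0]
    have h4 : -x - 2 * x ^ 2 = -(x + 2 * x ^ 2) := by ring
    rw [h4, Real.exp_neg]
    exact inv_le_of_inv_le₀ (by linarith) h3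
  calc _ = Real.exp (-x - 2 * x ^ 2) ^ k := by rw [← Real.exp_nat_mul]; congr 1; ring
    _ ≤ _ := by gcongr

/-- With `n = k + 4`, the joint bound omits four vertices where each mean omits two, so the ratio is
only `(1 - p²)⁻⁴`. -/
lemma disjoint_correlation_le {p : ℝ} (h0 : 0 < p) (hx8 : p ^ 2 ≤ 1 / 8) (k : ℕ) :
    p ^ 2 * ((1 - p ^ 2) ^ 2) ^ k / (p * (1 - p ^ 2) ^ (k + 2)) ^ 2 - 1 ≤ 8 * p ^ 2 := by
  have hy : 0 < 1 - p ^ 2 := by linarith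
  have h1 : p ^ 2 * ((1 - p ^ 2) ^ 2) ^ k / (p * (1 - p ^ 2) ^ (k + 2)) ^ 2 =
      1 / (1 - p ^ 2) ^ 4 := by
    generalize 1 - p ^ 2 = y at hy
    rw [div_eq_div_iff (by positivity) (by positivity)]
    ring
  rw [h1]
  exact inv_one_sub_pow_four_le (by positivity) hx8

/-- Each third vertex costs a factor at most `exp (2p³)` relative to independence, in total at most
`exp 2` because `np³ ≤ 1`. -/
lemma common_correlation_le {n p : ℝ} (h0 : 0 < p) (hx8 : p ^ 2 ≤ 1 / 8) {k : ℕ}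
    (hk : (k : ℝ) + 1 ≤ n) (hn : 2 ≤ n) (hp3 : n * p ^ 3 ≤ 1) :
    4 * n * (p ^ 2 * (1 - 2 * p ^ 2 + p ^ 3) ^ (k + 1)) /
      (n * (n - 1) * (p * (1 - p ^ 2) ^ (k + 2)) ^ 2) ≤ 16 * Real.exp 2 / n := by
  have hn0 : 0 < n := by linarith
  have hN : n ^ 2 / 2 ≤ n * (n - 1) := by nlinarith
  have hN0 : 0 < n * (n - 1) := mul_pos hn0 (by linarith)
  obtain ⟨y, hy⟩ : ∃ y, y = 1 - p ^ 2 := ⟨_, rfl⟩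
  rw [← hy]
  have hy0 : 0 < y := by linarith
  have h5 : (1 : ℝ) / 2 ≤ y ^ 2 := by nlinarith
  have h2 : (1 - 2 * p ^ 2 + p ^ 3) ^ (k + 1) ≤ Real.exp 2 * (y ^ 2) ^ (k + 1) := by
    have h3 : 1 - 2 * p ^ 2 + p ^ 3 ≤ Real.exp (2 * p ^ 3) * y ^ 2 := by
      have h4 : (2 * p ^ 3 + 1) * y ^ 2 ≤ Real.exp (2 * p ^ 3) * y ^ 2 := by
        gcongr; exact Real.add_one_le_exp _
      have h6 : p ^ 3 * (1 / 2) ≤ p ^ 3 * y ^ 2 := by gcongr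
      have h7 : y ^ 2 = 1 - 2 * p ^ 2 + (p ^ 2) ^ 2 := by rw [hy]; ring
      have h8 : 0 ≤ (p ^ 2) ^ 2 := by positivity
      linarith
    have h9 : 0 ≤ 1 - 2 * p ^ 2 + p ^ 3 := by
      have : 0 ≤ p ^ 3 := by positivity
      linarith
    calc (1 - 2 * p ^ 2 + p ^ 3) ^ (k + 1) ≤ (Real.exp (2 * p ^ 3) * y ^ 2) ^ (k + 1) :=
          pow_le_pow_left₀ h9 h3 _
      _ = Real.exp ((k + 1) * (2 * p ^ 3)) * (y ^ 2) ^ (k + 1) := by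
          rw [mul_pow, ← Real.exp_nat_mul]; push_cast; rfl
      _ ≤ _ := by
          gcongr
          have : ((k : ℝ) + 1) * p ^ 3 ≤ n * p ^ 3 := by gcongr
          linarith
  have h4 : (p * y ^ (k + 2)) ^ 2 = p ^ 2 * (y ^ 2) ^ (k + 1) * y ^ 2 := by ring
  rw [div_le_div_iff₀ (by positivity) hn0, h4]
  obtain ⟨z, hz⟩ : ∃ z, z = p ^ 2 * (y ^ 2) ^ (k + 1) := ⟨_, rfl⟩
  have hz0 : 0 ≤ z := by rw [hz]; positivity
  calc 4 * n * (p ^ 2 * (1 - 2 * p ^ 2 + p ^ 3) ^ (k + 1)) * n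
      ≤ 4 * n * (p ^ 2 * (Real.exp 2 * (y ^ 2) ^ (k + 1))) * n := by gcongr
    _ = 16 * Real.exp 2 * (n ^ 2 / 2 * (z * (1 / 2))) := by rw [hz]; ring
    _ ≤ 16 * Real.exp 2 * (n * (n - 1) * (z * y ^ 2)) := by gcongr
    _ = _ := by rw [hz]

lemma inv_mean_le {n p l : ℝ} (h0 : 0 < p) (hx8 : p ^ 2 ≤ 1 / 8) {k : ℕ}
    (hk : (k : ℝ) + 2 ≤ n) (hnexp : n = Real.exp l) (hl0 : 0 ≤ l)
    (hp4 : n * (p ^ 2) ^ 2 ≤ 1) (hL : n * p ^ 2 ≤ 5 / 4 * l) (hp : Real.exp (-(5 / 4 * l)) ≤ p) :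
    2 / (n * (n - 1) * (p * (1 - p ^ 2) ^ (k + 2))) ≤ 4 * Real.exp 3 * Real.exp (-(l / 4)) := by
  have hn : 2 ≤ n := le_trans (by linarith [Nat.cast_nonneg (α := ℝ) k]) hk
  have hn0 : 0 < n := by linarith
  have hN : n ^ 2 / 2 ≤ n * (n - 1) := by nlinarith
  have hN0 : 0 < n * (n - 1) := mul_pos hn0 (by linarith)
  have hy0 : 0 < 1 - p ^ 2 := by linarith
  have h2 : Real.exp (-(n * p ^ 2) - 2) ≤ (1 - p ^ 2) ^ (k + 2) := by
    have h3 := exp_neg_le_one_sub_pow (x := p ^ 2) (by positivity) hx8 (k + 2)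
    refine le_trans (Real.exp_le_exp.2 ?_) h3
    push_cast
    have h4 : ((k : ℝ) + 2) * p ^ 2 ≤ n * p ^ 2 := by gcongr
    have h5 : ((k : ℝ) + 2) * (p ^ 2) ^ 2 ≤ n * (p ^ 2) ^ 2 := by gcongr
    linarith
  have hnsq : n ^ 2 = Real.exp (2 * l) := by
    rw [hnexp, ← Real.exp_nat_mul]; push_cast; rfl
  -- If `np² ≤ 1`, the lower bound `p ≥ n^(-5/4)` suffices. If `np² ≥ 1`, then `p ≥ n^(-1/2)` and
  -- `exp (-np²) ≥ n^(-5/4)`, and the exponent is `2 - 1/2 - 5/4 = 1/4`.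
  have h3 : Real.exp (l / 4 - 1) ≤ n ^ 2 * p * Real.exp (-(n * p ^ 2)) := by
    rcases le_total (n * p ^ 2) 1 with h | h
    · calc Real.exp (l / 4 - 1) ≤ Real.exp (2 * l + -(5 / 4 * l) + -1) :=
            Real.exp_le_exp.2 (by linarith)
        _ = n ^ 2 * Real.exp (-(5 / 4 * l)) * Real.exp (-1) := by
            rw [Real.exp_add, Real.exp_add, hnsq]
        _ ≤ n ^ 2 * p * Real.exp (-(n * p ^ 2)) := by gcongr
    · have h4 : Real.exp (-(l / 2)) ≤ p := by
        refine le_of_pow_le_pow_left₀ two_ne_zero h0.le ?_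
        have : Real.exp (-(l / 2)) ^ 2 = 1 / n := by
          rw [one_div, hnexp, ← Real.exp_neg, ← Real.exp_nat_mul]
          congr 1; push_cast; ring
        rw [this, div_le_iff₀ hn0]; linarith
      calc Real.exp (l / 4 - 1) ≤ Real.exp (2 * l + -(l / 2) + -(5 / 4 * l)) :=
            Real.exp_le_exp.2 (by linarith)
        _ = n ^ 2 * Real.exp (-(l / 2)) * Real.exp (-(5 / 4 * l)) := by
            rw [Real.exp_add, Real.exp_add, hnsq]
        _ ≤ n ^ 2 * p * Real.exp (-(n * p ^ 2)) := by gcongr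
  rw [div_le_iff₀ (by positivity)]
  calc (2 : ℝ) = 4 * Real.exp 3 * Real.exp (-(l / 4)) *
        (1 / 2 * (Real.exp (l / 4 - 1) * Real.exp (-2))) := by
        have : Real.exp 3 * Real.exp (-(l / 4)) * (Real.exp (l / 4 - 1) * Real.exp (-2)) = 1 := by
          rw [← Real.exp_add, ← Real.exp_add, ← Real.exp_add, Real.exp_eq_one_iff]; ring
        linarith
    _ ≤ 4 * Real.exp 3 * Real.exp (-(l / 4)) *
        (1 / 2 * (n ^ 2 * p * Real.exp (-(n * p ^ 2)) * Real.exp (-2))) := by gcongr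
    _ = 4 * Real.exp 3 * Real.exp (-(l / 4)) *
        (n ^ 2 / 2 * (p * Real.exp (-(n * p ^ 2) - 2))) := by
        rw [sub_eq_add_neg, Real.exp_add]; ring
    _ ≤ _ := by gcongr

/-- Below the threshold it is unlikely that `G` is nonempty and has property `Q`. -/
lemma pr_sparse_le (h0 : 0 ≤ p) (h1 : p ≤ 1) {l : ℝ} (hl : l = Real.log (Fintype.card V))
    (hn : 32 ≤ Fintype.card V) (hl3 : (5 / 4 * l) ^ 3 ≤ Fintype.card V)
    (hL : Fintype.card V * p ^ 2 ≤ 5 / 4 * l) :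
    pr p {G : SimpleGraph V | EveryEdgeInTriangle G ∧ G ≠ ⊥} ≤
      10 * l / Fintype.card V + 16 * Real.exp 2 / Fintype.card V + 4 * Real.exp 3 *
        Real.exp (-(l / 4)) := by
  set n : ℝ := (Fintype.card V : ℝ) with hndef
  have hn32 : (32 : ℝ) ≤ n := by rw [hndef]; exact_mod_cast hn
  have hn0 : 0 < n := by linarith
  have hl0 : 0 ≤ l := by rw [hl]; exact Real.log_nonneg (by linarith)
  have hnexp : n = Real.exp l := by rw [hl, Real.exp_log hn0]
  have hpos1 : 0 ≤ 10 * l / n := by positivity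
  have hpos2 : 0 ≤ 16 * Real.exp 2 / n := by positivity
  -- For `p < n^(-5/4)` the expected number of triangles already vanishes; for larger `p` the
  -- expected number of edges in no triangle is large and Chebyshev applies.
  by_cases hp : p < Real.exp (-(5 / 4 * l))
  · refine (pr_everyEdgeInTriangle_ne_bot_le h0 h1).trans ?_
    have h2 : (n * p) ^ 3 ≤ Real.exp (-(l / 4)) := by
      calc (n * p) ^ 3 ≤ (n * Real.exp (-(5 / 4 * l))) ^ 3 := by gcongr
        _ = Real.exp (-(3 / 4 * l)) := by
          rw [hnexp, ← Real.exp_add, ← Real.exp_nat_mul]; congr 1; push_cast; ring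
        _ ≤ _ := Real.exp_le_exp.2 (by linarith)
    have h3 : (1 : ℝ) ≤ Real.exp 3 := Real.one_le_exp (by norm_num)
    have h4 : 1 * Real.exp (-(l / 4)) ≤ 4 * Real.exp 3 * Real.exp (-(l / 4)) := by
      gcongr; linarith
    linarith
  · rw [not_lt] at hp
    have hp0 : 0 < p := (Real.exp_pos _).trans_le hp
    have hx3 : (p ^ 2) ^ 3 * n ^ 2 ≤ 1 := by
      have h2 : (n * p ^ 2) ^ 3 ≤ n := (pow_le_pow_left₀ (by positivity) hL 3).trans hl3
      have h3 : n * ((p ^ 2) ^ 3 * n ^ 2) ≤ n * 1 := by linarith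
      exact le_of_mul_le_mul_left h3 hn0
    have hp3 : n * p ^ 3 ≤ 1 := by
      refine le_of_pow_le_pow_left₀ two_ne_zero zero_le_one ?_
      linarith
    have hx8 : p ^ 2 ≤ 1 / 8 := by
      by_contra! h
      have h2 : (1 / 8 : ℝ) ^ 3 < (p ^ 2) ^ 3 := by gcongr
      have h3 : (32 : ℝ) ^ 2 ≤ n ^ 2 := by gcongr
      nlinarith
    have hp4 : p ≤ 1 / 2 := by nlinarith
    have hp43 : n * (p ^ 2) ^ 2 ≤ 1 := by
      have : n * p ^ 3 * p ≤ 1 * 1 := mul_le_mul hp3 h1 h0 zero_le_one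
      linarith
    refine (pr_mono h0 h1 fun G hG => hG.1).trans ((pr_everyEdgeInTriangle_le hp0 (by linarith)
      (by omega) rfl rfl rfl rfl).trans ?_)
    rw [← hndef]
    obtain ⟨k, hk⟩ := Nat.exists_eq_add_of_le (show 4 ≤ Fintype.card V by omega)
    have e2 : Fintype.card V - 2 = k + 2 := by omega
    have e3 : Fintype.card V - 3 = k + 1 := by omega
    have e4 : Fintype.card V - 4 = k := by omega
    rw [e2, e3, e4]
    have hkn : (k : ℝ) + 4 = n := by rw [hndef, hk]; push_cast; ring
    have t1 := disjoint_correlation_le hp0 hx8 k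
    have t2 := common_correlation_le (n := n) (k := k) hp0 hx8 (by linarith) (by linarith) hp3
    have t3 := inv_mean_le (k := k) hp0 hx8 (by linarith) hnexp hl0 hp43 hL hp
    have t4 : 8 * p ^ 2 ≤ 10 * l / n := by
      rw [le_div_iff₀ hn0]
      linarith
    linarith

/-- The bound for the failure probability of regularity. -/
noncomputable def denseBound (ε n : ℝ) : ℝ :=
  2 * (n * Real.exp (1 - ε ^ 2 / 4 * √n)) + 2 / n + 2 * (n * Real.exp (-√n)) +
    40 * Real.exp (4 - Real.log n / 8) + Real.exp (-n)

lemma pr_not_linkRegular_le_denseBound (h0 : 0 ≤ p) (h1 : p ≤ 1) {ε η l : ℝ} (hε : 0 < ε)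
    (hε1 : ε ≤ 1 / 200) (hη : 0 < η) (hn : 2 ≤ Fintype.card V)
    (hl : l = Real.log (Fintype.card V)) (hL : 5 / 4 * l ≤ Fintype.card V * p ^ 2) (hl1 : 1 ≤ l)
    (hκL : 6 ≤ ε ^ 2 / 16 * Real.exp (-(6 / ε)) * l) (hηL : 3 ≤ η * l / 128) :
    pr p {G : SimpleGraph V | ¬ LinkRegular G p ε (Real.exp (-(6 / ε))) η} ≤
      denseBound ε (Fintype.card V) := by
  set n : ℝ := (Fintype.card V : ℝ) with hndef
  have hn0 : 0 < n := by rw [hndef]; positivity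
  set L : ℝ := n * p ^ 2 with hLdef
  set m : ℝ := n * p with hm
  have hlL : l ≤ L := by linarith
  have hLm : L = m * p := by rw [hLdef, hm]; ring
  refine (pr_not_linkRegular_le h0 h1 hε hε1 hη hm hLm hn (by rwa [← hndef, ← hl])
    (hκL.trans ?_) (hηL.trans ?_)).trans ?_
  · gcongr
  · gcongr
  · have hmn : √n ≤ m := by
      rw [Real.sqrt_le_left (by positivity)]
      have : n * 1 ≤ n * L := by gcongr; linarith
      have h2 : m ^ 2 = n * L := by rw [hm, hLdef]; ring
      linarith
    -- Here `n(2m)² = 4Ln²` and `L ≤ 10 exp (L/10)`, so the exponent is `2l - (17/10)L + 4`, at most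
    -- `4 - l/8` since `L ≥ (5/4)l`. This is the constraint that bounds 5/4 from below.
    have h3 : n * ((2 * m) ^ 2 * Real.exp (4 - 9 / 5 * L)) ≤ 40 * Real.exp (4 - l / 8) := by
      have h4 : n ^ 2 = Real.exp (2 * l) := by
        rw [hl, ← Real.exp_log hn0, ← Real.exp_nat_mul, Real.log_exp]; push_cast; rfl
      have h5 : L ≤ 10 * Real.exp (L / 10) := by linarith [Real.add_one_le_exp (L / 10)]
      calc n * ((2 * m) ^ 2 * Real.exp (4 - 9 / 5 * L))
          = 4 * L * (n ^ 2 * Real.exp (4 - 9 / 5 * L)) := by rw [hLdef, hm]; ring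
        _ ≤ 4 * (10 * Real.exp (L / 10)) * (n ^ 2 * Real.exp (4 - 9 / 5 * L)) := by gcongr
        _ = 40 * Real.exp (L / 10 + (2 * l + (4 - 9 / 5 * L))) := by
            rw [h4, Real.exp_add, Real.exp_add]; ring
        _ ≤ _ := by gcongr; linarith
    rw [denseBound, ← hl]
    gcongr

lemma tendsto_mul_exp_neg_sqrt {c : ℝ} (hc : 0 < c) :
    Tendsto (fun n : ℕ => (n : ℝ) * Real.exp (-(c * √n))) atTop (𝓝 0) := by
  have h1 := (isLittleO_pow_exp_pos_mul_atTop 2 hc).tendsto_div_nhds_zero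
  have h2 : Tendsto (fun n : ℕ => √(n : ℝ)) atTop atTop :=
    Real.tendsto_sqrt_atTop.comp tendsto_natCast_atTop_atTop
  refine (h1.comp h2).congr fun n => ?_
  simp only [Function.comp, Real.sq_sqrt (Nat.cast_nonneg n), Real.exp_neg, div_eq_mul_inv]

lemma tendsto_log_natCast : Tendsto (fun n : ℕ => Real.log n) atTop atTop :=
  Real.tendsto_log_atTop.comp tendsto_natCast_atTop_atTop

lemma tendsto_denseBound {ε : ℝ} (hε : 0 < ε) :
    Tendsto (fun n : ℕ => denseBound ε n) atTop (𝓝 0) := by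
  have h1 := ((tendsto_mul_exp_neg_sqrt (c := ε ^ 2 / 4) (by positivity)).const_mul
    (2 * Real.exp 1))
  have h2 : Tendsto (fun n : ℕ => 2 / (n : ℝ)) atTop (𝓝 0) := tendsto_const_div_atTop_nhds_zero_nat 2
  have h3 := (tendsto_mul_exp_neg_sqrt (c := 1) one_pos).const_mul 2
  have h4 : Tendsto (fun n : ℕ => 40 * Real.exp (4 - Real.log n / 8)) atTop (𝓝 (40 * 0)) := by
    refine Tendsto.const_mul _ (Real.tendsto_exp_atBot.comp ?_)
    refine tendsto_atBot_add_const_left _ _ ?_ |>.congr fun n => (sub_eq_add_neg _ _).symm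
    exact tendsto_neg_atTop_atBot.comp (tendsto_log_natCast.atTop_div_const (by norm_num))
  have h5 : Tendsto (fun n : ℕ => Real.exp (-(n : ℝ))) atTop (𝓝 0) :=
    Real.tendsto_exp_neg_atTop_nhds_zero.comp tendsto_natCast_atTop_atTop
  have h := (((h1.add h2).add h3).add h4).add h5
  simp only [mul_zero, add_zero] at h
  refine h.congr fun n => ?_
  rw [denseBound, sub_eq_add_neg 1, Real.exp_add 1]
  simp only [one_mul]
  ring

/-- The bound for the probability of property `Q` below the threshold. -/
noncomputable def sparseBound (n : ℝ) : ℝ :=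
  10 * Real.log n / n + 16 * Real.exp 2 / n + 4 * Real.exp 3 * Real.exp (-(Real.log n / 4))

lemma tendsto_sparseBound : Tendsto (fun n : ℕ => sparseBound n) atTop (𝓝 0) := by
  have h1 : Tendsto (fun n : ℕ => 10 * (Real.log n / n)) atTop (𝓝 (10 * 0)) := by
    refine Tendsto.const_mul _ ?_
    exact (Real.isLittleO_log_id_atTop.tendsto_div_nhds_zero).comp tendsto_natCast_atTop_atTop
  have h2 := tendsto_const_div_atTop_nhds_zero_nat (𝕜 := ℝ) (16 * Real.exp 2)
  have h3 : Tendsto (fun n : ℕ => 4 * Real.exp 3 * Real.exp (-(Real.log n / 4))) atTop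
      (𝓝 (4 * Real.exp 3 * 0)) :=
    Tendsto.const_mul _ (Real.tendsto_exp_neg_atTop_nhds_zero.comp
      (tendsto_log_natCast.atTop_div_const (by norm_num)))
  have h := (h1.add h2).add h3
  simp only [mul_zero, add_zero] at h
  refine h.congr fun n => ?_
  rw [sparseBound, mul_div_assoc 10]

lemma eventually_log_pow_le :
    ∀ᶠ n : ℕ in atTop, (5 / 4 * Real.log n) ^ 3 ≤ (n : ℝ) := by
  have h := (isLittleO_log_rpow_atTop (show (0 : ℝ) < 1 / 3 by norm_num)).bound
    (show (0 : ℝ) < 4 / 5 by norm_num)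
  filter_upwards [tendsto_natCast_atTop_atTop.eventually h, eventually_ge_atTop 1] with n hn hn1
  have hn1' : (1 : ℝ) ≤ n := by exact_mod_cast hn1
  have hl : 0 ≤ Real.log n := Real.log_nonneg hn1'
  rw [Real.norm_of_nonneg hl, Real.norm_of_nonneg (by positivity)] at hn
  calc (5 / 4 * Real.log n) ^ 3 ≤ ((n : ℝ) ^ (1 / 3 : ℝ)) ^ 3 := by
        gcongr; linarith
    _ = (n : ℝ) := by rw [← Real.rpow_natCast, ← Real.rpow_mul (by positivity)]; norm_num

end Asymptotics
end TriangleSpace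

/-! ### The theorem: splitting the range of `p` at `np² = (5/4) log n`. -/

open Filter Topology
theorem lemma3p1 (η : ℝ) (hη : 0 < η) :
    Tendsto
      (fun n : ℕ => ⨆ p : unitInterval,
        SimpleGraph.binomialRandom (Fin n) p
          {G : SimpleGraph (Fin n) | TriangleSpace.EveryEdgeInTriangle G ∧
            ∃ F : G.edgeSet → ZMod 2,
              F ∈ TriangleSpace.perp (TriangleSpace.triangleSpace G) ∧
              F ∉ TriangleSpace.perp (TriangleSpace.cycleSpace G) ∧
              (TriangleSpace.size F : ℝ) < (1 - η) * (n : ℝ) ^ 2 * (p : ℝ) / 4})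
      atTop (𝓝 0) := by
  set ε : ℝ := η ^ 2 / 100000 with hε
  have hε0 : 0 < ε := by positivity
  set κ : ℝ := Real.exp (-(6 / ε)) with hκ
  have hκ0 : 0 < κ := Real.exp_pos _
  -- A single bound free of `p`, covering both ranges, so the supremum is controlled termwise.
  set b : ℕ → ℝ := fun n => TriangleSpace.sparseBound n + TriangleSpace.denseBound ε n with hb
  have hb0 : Tendsto (fun n => ENNReal.ofReal (b n)) atTop (𝓝 0) := by
    have := TriangleSpace.tendsto_sparseBound.add (TriangleSpace.tendsto_denseBound hε0)
    rw [add_zero] at this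
    simpa using ENNReal.tendsto_ofReal this
  refine tendsto_of_tendsto_of_tendsto_of_le_of_le' tendsto_const_nhds hb0
    (Eventually.of_forall fun _ => zero_le) ?_
  have hlog := TriangleSpace.tendsto_log_natCast
  have hsqrt : Tendsto (fun n : ℕ => √(n : ℝ)) atTop atTop :=
    Real.tendsto_sqrt_atTop.comp tendsto_natCast_atTop_atTop
  filter_upwards [eventually_ge_atTop 32, TriangleSpace.eventually_log_pow_le,
    hlog.eventually_ge_atTop 1,
    (hlog.const_mul_atTop (show 0 < ε ^ 2 / 16 * κ by positivity)).eventually_ge_atTop 6,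
    (hlog.const_mul_atTop (show 0 < η / 128 by positivity)).eventually_ge_atTop 3,
    (hsqrt.const_mul_atTop (show 0 < ε * κ by positivity)).eventually_ge_atTop 2]
    with n hn hl3 hl1 hκL hηL hbig
  refine iSup_le fun p => ?_
  obtain ⟨h0, h1⟩ : 0 ≤ (p : ℝ) ∧ (p : ℝ) ≤ 1 := p.2
  rw [← MeasureTheory.ofReal_measureReal, TriangleSpace.binomialRandom_real]
  refine ENNReal.ofReal_le_ofReal ?_
  have hcard : Fintype.card (Fin n) = n := Fintype.card_fin n
  have hn0 : (0 : ℝ) < n := by positivity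
  have hs0 : 0 ≤ TriangleSpace.sparseBound n := by unfold TriangleSpace.sparseBound; positivity
  have hd0 : 0 ≤ TriangleSpace.denseBound ε n := by unfold TriangleSpace.denseBound; positivity
  rcases le_or_gt ((n : ℝ) * (p : ℝ) ^ 2) (5 / 4 * Real.log n) with hL | hL
  · have := TriangleSpace.pr_sparse_le (V := Fin n) h0 h1 (l := Real.log n) (by rw [hcard])
      (by rwa [hcard]) (by rwa [hcard]) (by rwa [hcard])
    rw [hcard] at this
    refine (TriangleSpace.pr_mono h0 h1 fun G hG => ?_).trans
      (this.trans (le_add_of_nonneg_right hd0))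
    obtain ⟨hQ, F, -, hC, -⟩ := hG
    exact ⟨hQ, fun h => hC (TriangleSpace.mem_perp_of_eq_bot h F _)⟩
  · have hp0 : 0 < (p : ℝ) := by
      refine lt_of_le_of_ne h0 fun h => ?_
      rw [← h] at hL
      norm_num at hL
      linarith
    -- For `η ≥ 1` the size bound is nonpositive and the event is empty.
    rcases le_or_gt 1 η with hη1 | hη1
    · refine le_trans (TriangleSpace.pr_mono h0 h1 (S' := ∅) fun G hG => ?_) ?_
      · obtain ⟨-, F, -, -, hF⟩ := hG
        have h2 : (1 - η) * (n : ℝ) ^ 2 * p ≤ 0 :=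
          mul_nonpos_of_nonpos_of_nonneg
            (mul_nonpos_of_nonpos_of_nonneg (by linarith) (by positivity)) h0
        have h3 : (0 : ℝ) ≤ TriangleSpace.size F := Nat.cast_nonneg _
        linarith
      · rw [TriangleSpace.pr, Set.indicator_empty]
        exact (TriangleSpace.ex_const _ 0).trans_le (add_nonneg hs0 hd0)
    · have hε200 : ε ≤ 1 / 200 := by rw [hε]; nlinarith
      have hκ8 : κ ≤ 1 / 8 := by
        have h2 : 8 ≤ 6 / ε := by rw [le_div_iff₀ hε0]; linarith
        have h3 : Real.exp (-(6 / ε)) = (Real.exp (6 / ε))⁻¹ := Real.exp_neg _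
        have h4 := Real.add_one_le_exp (6 / ε)
        rw [hκ, h3, one_div]
        exact inv_anti₀ (by norm_num) (by linarith)
      have := TriangleSpace.pr_not_linkRegular_le_denseBound (V := Fin n) h0 h1 hε0 hε200 hη
        (by rw [hcard]; omega) (l := Real.log n) (by rw [hcard]) (by rw [hcard]; exact hL.le) hl1
        hκL (by linarith)
      rw [hcard] at this
      refine (TriangleSpace.pr_mono h0 h1 fun G hG hreg => ?_).trans
        (this.trans (le_add_of_nonneg_left hs0))
      obtain ⟨hQ, F, hT, hC, hF⟩ := hG
      refine absurd hF (not_lt.2 ?_)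
      -- Since `np² ≥ 1`, one has `(np)² = n · np² ≥ n`; this turns the eventual bound in `√n` into
      -- one in the mean degree, uniformly in `p`.
      have hnp : √(n : ℝ) ≤ n * p := by
        rw [Real.sqrt_le_left (by positivity)]
        have h2 : (n : ℝ) * 1 ≤ n * (n * (p : ℝ) ^ 2) := by gcongr; linarith
        linarith
      have hfin := hreg.le_size_of_mem_perp hη hη1 hκ0 hκ8 hp0 (by rw [hcard]; omega)
        (by
          rw [hcard, ← hε]
          have : ε * κ * √(n : ℝ) ≤ ε * κ * (n * p) := by gcongr
          linarith) hQ hT hC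
      rwa [hcard] at hfin
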